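/- Let $0<\alpha<1$, let $k_1,k_2,c_1,c_2,\rho,l>0$, let $\lambda_1,\lambda_2>0$ with $\lambda_j^2=\frac{k_j}{\rho c_j}$, put $\lambda=\lambda_1/\lambda_2$, and let $u_i<u_m<u_0$ be real numbers. For $a>-1$ and $b\in\mathbb R$ let $W(z,a,b)=\sum_{k\ge 0}\frac{z^k}{k!\,\Gamma(ak+b)}$ be the Wright function (with $1/\Gamma=0$ at the poles of $\Gamma$), and for $0<\nu<1$ let $M_\nu(z)=W(-z,-\nu,1-\nu)$ be the Mainardi function. Let $D^{\alpha}f(t)=\frac{1}{\Gamma(1-\alpha)}\int_0^t (t-\tau)^{-\alpha}f'(\tau)\,d\tau$ be the Caputo derivative with base point $0$ (in the time variable), where $f$ is continuous on $[0,t]$ and differentiable on $(0,t]$ and the integral converges absolutely. For $x>0$ put $$F_1(x)=\frac{M_{\alpha/2}(x)}{1-W(-x,-\frac{\alpha}{2},1)},\qquad F_2(x)=\frac{M_{\alpha/2}(x)}{W(-x,-\frac{\alpha}{2},1)},$$ $$F(x)=\frac{k_2(u_0-u_m)}{\rho l\lambda_1\lambda_2}F_1(\lambda x)-\frac{k_1(u_m-u_i)}{\rho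 l\lambda_1^2}F_2(x).$$ Then the equation $$F(\xi)=\frac{\Gamma(1+\frac{\alpha}{2})}{\Gamma(1-\frac{\alpha}{2})}\,\xi,\qquad \xi>0,$$ has at least one solution, and for every solution $\xi>0$ of it the functions $$u_2(x,t)=u_0-(u_0-u_m)\frac{1-W\left(-\frac{x}{\lambda_2t^{\alpha/2}},-\frac{\alpha}{2},1\right)}{1-W\left(-\xi\lambda,-\frac{\alpha}{2},1\right)},\qquad u_1(x,t)=u_i+(u_m-u_i)\frac{W\left(-\frac{x}{\lambda_1t^{\alpha/2}},-\frac{\alpha}{2},1\right)}{W\left(-\xi,-\frac{\alpha}{2},1\right)},\qquad s(t)=\xi\lambda_1t^{\alpha/2}$$ (where at $t=0$, $x>0$ the term $W(-\frac{x}{\lambda_jt^{\alpha/2}},-\frac{\alpha}{2},1)$ is read as its limit $W(-\infty,-\frac{\alpha}{2},1)=0$) are a solution of the two-phase fractional Lamé-Clapeyron-Stefan problem $$\begin{cases} D^{\alpha}u_2(x,t)=\lambda_2^2\,\frac{\partial^2u_2}{\partial x^2}(x,t), & 0<x<s(t),\ t>0,\\ D^{\alpha}u_1(x,t)=\lambda_1^2\,\frac{\partial^2u_1}{\partial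 x^2}(x,t), & x>s(t),\ t>0,\\ k_1\frac{\partial u_1}{\partial x}(s(t),t)-k_2\frac{\partial u_2}{\partial x}(s(t),t)=\rho l\,D^{\alpha}s(t), & t>0,\\ u_1(s(t),t)=u_2(s(t),t)=u_m, & t>0,\\ u_1(x,0)=u_i \ (x>0),\qquad \lim_{x\to+\infty}u_1(x,t)=u_i, & t>0,\\ u_2(0,t)=u_0, & t>0,\\ s(0)=0. \end{cases}$$ Here $u_1,u_2$ are regarded as functions on the whole quadrant $x>0$, $t\ge 0$ (and $x=0$, $t>0$), so that $D^\alpha u_2(x,t)$ integrates over all times in $(0,t)$; $s(t)>0$ for $t>0$; $u_2$ is continuous on $\{t>0,\ 0\le x\le s(t)\}$ and $u_1$ on $\{t\ge 0,\ x>0,\ x\ge s(t)\}$; in the interior of its phase each $u_j(\cdot,t)$, $t>0$, is twice continuously differentiable; and the space derivatives at $x=s(t)$ are taken from the side of the respective phase. -/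

import Mathlib

open Set Filter Topology

noncomputable section

/-- The Wright function `W(z; a; b) = ∑ z^k / (k! Γ(a k + b))` at a real argument. At the poles of
`Γ` the Mathlib conventions give `1 / Γ = 0`, which is the value of the entire function `1 / Γ`. -/
def wright (z a b : ℝ) : ℝ :=
  ∑' k : ℕ, z ^ k / ((k.factorial : ℝ) * Real.Gamma (a * k + b))

/-- The Mainardi function `M_ν(z) = W(-z; -ν; 1 - ν)`. -/
def mainardi (ν z : ℝ) : ℝ := wright (-z) (-ν) (1 - ν)

/-- The Caputo derivative of order `α ∈ (0, 1)` with base point `0`: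
`(1 / Γ(1 - α)) ∫_0^t (t - τ)^(-α) f'(τ) dτ`. -/
def caputoDeriv (α : ℝ) (f : ℝ → ℝ) (t : ℝ) : ℝ :=
  1 / Real.Gamma (1 - α) * ∫ τ in (0 : ℝ)..t, (t - τ) ^ (-α) * deriv f τ

/-- The Caputo derivative of order `α ∈ (0, 1)` of `f` at `t > 0` exists (`f` is continuous on
`[0, t]`, differentiable on `(0, t]`, and the defining integral converges absolutely), and it
equals `v`. -/
structure HasCaputoDeriv (α : ℝ) (f : ℝ → ℝ) (v t : ℝ) : Prop where
  continuousOn : ContinuousOn f (Icc 0 t)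
  differentiableAt : ∀ τ ∈ Ioc 0 t, DifferentiableAt ℝ f τ
  integrable : IntervalIntegrable (fun τ => (t - τ) ^ (-α) * deriv f τ) MeasureTheory.volume 0 t
  eq : caputoDeriv α f t = v

/-- `(u₁, u₂, s)` is a solution of the two-phase fractional Lamé-Clapeyron-Stefan problem of order
`α`; `u₁` is the solid and `u₂` the liquid temperature, `u x t` being the value at position `x` and
time `t`, and `s` is the free boundary. The temperatures are functions on the whole quadrant: the
integral in the Caputo derivative of `u₂ x` at `t` runs over all of `(0, t)`, also over the times
`τ` at which `s τ < x`. -/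
structure IsFractionalStefanSolution (α k₁ k₂ ρ l lam₁ lam₂ u₀ um ui : ℝ)
    (u₁ u₂ : ℝ → ℝ → ℝ) (s : ℝ → ℝ) : Prop where
  s_pos : ∀ t, 0 < t → 0 < s t
  /-- `u₂` is continuous up to the fixed face and up to the free boundary. -/
  continuousOn_liquid :
    ContinuousOn (fun p : ℝ × ℝ => u₂ p.1 p.2) {p | 0 < p.2 ∧ 0 ≤ p.1 ∧ p.1 ≤ s p.2}
  /-- `u₁` is continuous up to the free boundary and up to the initial time. -/
  continuousOn_solid :
    ContinuousOn (fun p : ℝ × ℝ => u₁ p.1 p.2) {p | 0 ≤ p.2 ∧ 0 < p.1 ∧ s p.2 ≤ p.1}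
  /-- `u₂ₓₓ` exists in the liquid phase. -/
  smooth_liquid : ∀ x t, 0 < t → 0 < x → x < s t → ContDiffAt ℝ 2 (fun y => u₂ y t) x
  /-- `u₁ₓₓ` exists in the solid phase. -/
  smooth_solid : ∀ x t, 0 < t → s t < x → ContDiffAt ℝ 2 (fun y => u₁ y t) x
  /-- `D^α u₂ = λ₂² u₂ₓₓ` in the liquid phase. -/
  eq_liquid : ∀ x t, 0 < t → 0 < x → x < s t →
    HasCaputoDeriv α (fun τ => u₂ x τ) (lam₂ ^ 2 * iteratedDeriv 2 (fun y => u₂ y t) x) t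
  /-- `D^α u₁ = λ₁² u₁ₓₓ` in the solid phase. -/
  eq_solid : ∀ x t, 0 < t → s t < x →
    HasCaputoDeriv α (fun τ => u₁ x τ) (lam₁ ^ 2 * iteratedDeriv 2 (fun y => u₁ y t) x) t
  /-- `k₁ u₁ₓ(s(t), t) - k₂ u₂ₓ(s(t), t) = ρ l D^α s(t)`, with the derivatives at the free
  boundary taken from the side of the respective phase. -/
  stefan : ∀ t, 0 < t → ∃ g₁ g₂ d : ℝ,
    HasDerivWithinAt (fun x => u₁ x t) g₁ (Ici (s t)) (s t) ∧
    HasDerivWithinAt (fun x => u₂ x t) g₂ (Iic (s t)) (s t) ∧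
    HasCaputoDeriv α s d t ∧
    k₁ * g₁ - k₂ * g₂ = ρ * l * d
  interface_solid : ∀ t, 0 < t → u₁ (s t) t = um
  interface_liquid : ∀ t, 0 < t → u₂ (s t) t = um
  initial : ∀ x, 0 < x → u₁ x 0 = ui
  far_field : ∀ t, 0 < t → Tendsto (fun x => u₁ x t) atTop (𝓝 ui)
  boundary : ∀ t, 0 < t → u₂ 0 t = u₀
  s_zero : s 0 = 0

/-- The self-similar profile `W(-x / (λ t^(α/2)); -α/2; 1)` for `t > 0`; at `t = 0` it takes the
value `W(-∞; -α/2; 1) = 0`. -/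
def wrightProfile (α lam x t : ℝ) : ℝ :=
  if 0 < t then wright (-(x / (lam * t ^ (α / 2)))) (-(α / 2)) 1 else 0

/-- The liquid temperature `u₂` of the generalized Neumann solution. -/
def neumannLiquid (α lam₁ lam₂ u₀ um ξ x t : ℝ) : ℝ :=
  u₀ - (u₀ - um) * ((1 - wrightProfile α lam₂ x t) /
    (1 - wright (-(ξ * (lam₁ / lam₂))) (-(α / 2)) 1))

/-- The solid temperature `u₁` of the generalized Neumann solution. -/
def neumannSolid (α lam₁ um ui ξ x t : ℝ) : ℝ :=
  ui + (um - ui) * (wrightProfile α lam₁ x t / wright (-ξ) (-(α / 2)) 1)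

/-- The free boundary `s(t) = ξ λ₁ t^(α/2)` of the generalized Neumann solution. -/
def neumannFront (α lam₁ ξ t : ℝ) : ℝ := ξ * lam₁ * t ^ (α / 2)

/-- `F₁(x) = M_{α/2}(x) / (1 - W(-x; -α/2; 1))`. -/
def stefanF₁ (α x : ℝ) : ℝ := mainardi (α / 2) x / (1 - wright (-x) (-(α / 2)) 1)

/-- `F₂(x) = M_{α/2}(x) / W(-x; -α/2; 1)`. -/
def stefanF₂ (α x : ℝ) : ℝ := mainardi (α / 2) x / wright (-x) (-(α / 2)) 1

/-- `F(x) = k₂ (u₀ - u_m) / (ρ l λ₁ λ₂) F₁(λ x) - k₁ (u_m - u_i) / (ρ l λ₁²) F₂(x)` with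
`λ = λ₁ / λ₂`. -/
def stefanF (α k₁ k₂ ρ l lam₁ lam₂ u₀ um ui x : ℝ) : ℝ :=
  k₂ * (u₀ - um) / (ρ * l * lam₁ * lam₂) * stefanF₁ α (lam₁ / lam₂ * x) -
    k₁ * (um - ui) / (ρ * l * lam₁ ^ 2) * stefanF₂ α x

end

/-!
Write `ν = α / 2 ∈ (0, 1 / 2)`, `W_b(z) = W(z; -ν; b)` and, for `c > 0`,
`g_b(t) = t ^ (b - 1) W_b(-c t ^ (-ν))` (`wrightTime`). With `c = x / λ` the self-similar profile
is `g_1`, and its time derivative is `g_0`. Everything rests on the Laplace transform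
`∫ exp (-s t) g_b(t) dt = s ^ (-b) exp (-c s ^ ν)` for `b < 1` (`laplace_wrightTime`).

*The Laplace transform.* The power series of `W_b` cannot be transformed termwise, since the powers
`t ^ (-ν k)` are not integrable at `0`. By the reflection formula, however, it is the termwise
integral of a second series, which gives `g_b` as `1 / π` times the Laplace transform of the
oscillating density `r ^ (-b) Im (exp (iπb - c r ^ ν exp (-iπν)))`
(`integral_exp_mul_wrightDensity`). This density decays because `cos (πν) > 0`, and a second Laplace
transform turns it into a Stieltjes transform. That transform is evaluated by Cauchy's theorem for
`exp (-c z ^ ν) z ^ (-b)` on the plane cut along the negative axis; in the variable `w = log z` this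
is a shift of a line of integration across the strip `|Im w| ≤ π`
(`integral_wrightDensity_div_add`).

*Positivity and uniqueness.* A bounded continuous function on `(0, ∞)` is nonnegative if its Laplace
transform at the positive integers is a Hausdorff moment sequence, by Weierstrass approximation in
the variable `exp (-t)` (`nonneg_of_laplace_isHausdorffPositive`). Moment sequences are closed under
products, exponentials and limits, and `s ^ ν` is proportional to
`∫ t ^ ν (1 / t - 1 / (t + s)) dt`, so that `exp (-c s ^ ν)` is one. Hence `g_0 ≥ 0`, which is
`M_ν ≥ 0`. Since `∫ g_0 = 1`, the profile tends to `0` as `t → 0`; by monotonicity and analyticity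
`0 < W_1(-x) < 1` for `x > 0`. The same criterion, applied to a function and its negative, gives
uniqueness of Laplace transforms and therefore the fractional integral
`I ^ (1 - 2ν) g_0 = g_{1 - 2ν}` (`fractionalIntegral_wrightTime`). This is the fractional diffusion
equation for the profile, because two space derivatives lower `b` by `2ν` as well.

*The front.* As `x → 0` the function `F₁` blows up and `F₂` stays bounded; at infinity `F₁` is
bounded and `F₂ ≥ 0`, so the intermediate value theorem yields a root `ξ`. For every root, the Stefan
condition is the equation for `ξ`, since `D^α t ^ ν = Γ(1 + ν) / Γ(1 - ν) t ^ (-ν)`.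
-/

open MeasureTheory

/-! ### The Wright function as an entire function -/

/-- Reflection formula for the reciprocal Gamma function; it also holds at the poles of `Γ`. -/
theorem one_div_Gamma_eq_sin_mul {x : ℝ} (hx : x < 1) :
    1 / Real.Gamma x = Real.Gamma (1 - x) * Real.sin (Real.pi * x) / Real.pi := by
  have hpos : 0 < Real.Gamma (1 - x) := Real.Gamma_pos_of_pos (by linarith)
  have h := Real.Gamma_mul_Gamma_one_sub x
  by_cases hs : Real.sin (Real.pi * x) = 0
  · rw [hs, div_zero] at h
    have h0 : Real.Gamma x = 0 := by
      rcases mul_eq_zero.mp h with h | h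
      · exact h
      · exact absurd h hpos.ne'
    simp [h0, hs]
  · have h0 : Real.Gamma x ≠ 0 := by
      intro h0
      rw [h0, zero_mul] at h
      exact div_ne_zero Real.pi_ne_zero hs h.symm
    rw [eq_div_iff hs] at h
    rw [div_eq_div_iff h0 Real.pi_ne_zero]
    linarith

theorem Gamma_add_le_mul_rpow {x ν : ℝ} (hx : 0 < x) (hν₀ : 0 < ν) (hν₁ : ν < 1) :
    Real.Gamma (x + ν) ≤ Real.Gamma x * x ^ ν := by
  have h := Real.Gamma_mul_add_mul_le_rpow_Gamma_mul_rpow_Gamma hx (t := x + 1) (by linarith)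
    (a := 1 - ν) (b := ν) (by linarith) hν₀ (by ring)
  have hG := Real.Gamma_pos_of_pos hx
  rw [Real.Gamma_add_one hx.ne', Real.mul_rpow hx.le hG.le] at h
  calc Real.Gamma (x + ν) = Real.Gamma ((1 - ν) * x + ν * (x + 1)) := by ring_nf
    _ ≤ _ := h
    _ = Real.Gamma x ^ ((1 - ν) + ν) * x ^ ν := by rw [Real.rpow_add hG]; ring
    _ = _ := by simp

theorem summable_Gamma_mul_pow_div_factorial {ν a : ℝ} (hν₀ : 0 < ν) (hν₁ : ν < 1) (ha : 0 < a)
    (R : ℝ) :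
    Summable fun k : ℕ => Real.Gamma (ν * k + a) * |R| ^ k / (k.factorial : ℝ) := by
  have hpos : ∀ k : ℕ, 0 < ν * k + a := fun k => by positivity
  -- the ratio of consecutive terms is at most `|R| (ν k + a) ^ ν / (k + 1)`, which tends to `0`
  have hlim : Tendsto (fun k : ℕ => |R| * (ν * k + a) ^ ν / ((k : ℝ) + 1)) atTop (𝓝 0) := by
    have h1 : Tendsto (fun k : ℕ => |R| * ((ν + a) ^ ν) * ((k : ℝ) + 1) ^ (-(1 - ν))) atTop
        (𝓝 (|R| * ((ν + a) ^ ν) * 0)) := by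
      refine Tendsto.const_mul _ ?_
      exact (tendsto_rpow_neg_atTop (by linarith)).comp
        (tendsto_atTop_add_const_right _ _ tendsto_natCast_atTop_atTop)
    rw [mul_zero] at h1
    refine squeeze_zero (fun k => ?_) (fun k => ?_) h1
    · have := hpos k
      positivity
    · have hk : (0 : ℝ) < (k : ℝ) + 1 := by positivity
      have h2 : (ν * k + a) ^ ν ≤ ((ν + a) * ((k : ℝ) + 1)) ^ ν := by
        refine Real.rpow_le_rpow (hpos k).le ?_ hν₀.le
        have : (0 : ℝ) ≤ k := by positivity
        nlinarith
      rw [Real.mul_rpow (by positivity) hk.le] at h2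
      have h3 : ((k : ℝ) + 1) ^ (-(1 - ν)) = ((k : ℝ) + 1) ^ ν / ((k : ℝ) + 1) := by
        rw [show -(1 - ν) = ν - 1 by ring, Real.rpow_sub_one hk.ne']
      rw [h3]
      calc |R| * (ν * k + a) ^ ν / ((k : ℝ) + 1)
          ≤ |R| * ((ν + a) ^ ν * ((k : ℝ) + 1) ^ ν) / ((k : ℝ) + 1) := by gcongr
        _ = _ := by ring
  refine summable_of_ratio_norm_eventually_le (r := 1 / 2) (by norm_num) ?_
  filter_upwards [hlim.eventually (eventually_le_nhds (show (0 : ℝ) < 1 / 2 by norm_num))] with k hk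
  have hG := Real.Gamma_pos_of_pos (hpos k)
  have hG' := Real.Gamma_pos_of_pos (hpos (k + 1))
  rw [Real.norm_of_nonneg (by positivity), Real.norm_of_nonneg (by positivity)]
  have h := Gamma_add_le_mul_rpow (hpos k) hν₀ hν₁
  have h4 : ν * ((k + 1 : ℕ) : ℝ) + a = ν * k + a + ν := by push_cast; ring
  rw [h4, Nat.factorial_succ, pow_succ]
  push_cast
  calc Real.Gamma (ν * k + a + ν) * (|R| ^ k * |R|) / (((k : ℝ) + 1) * (k.factorial : ℝ))
      ≤ Real.Gamma (ν * k + a) * (ν * k + a) ^ ν * (|R| ^ k * |R|) /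
        (((k : ℝ) + 1) * (k.factorial : ℝ)) := by gcongr
    _ = |R| * (ν * k + a) ^ ν / ((k : ℝ) + 1) *
        (Real.Gamma (ν * k + a) * |R| ^ k / (k.factorial : ℝ)) := by
        field_simp
    _ ≤ _ := by gcongr

theorem abs_one_div_Gamma_le {x : ℝ} (hx : x < 1) :
    |1 / Real.Gamma x| ≤ Real.Gamma (1 - x) := by
  have hpos : 0 < Real.Gamma (1 - x) := Real.Gamma_pos_of_pos (by linarith)
  rw [one_div_Gamma_eq_sin_mul hx, abs_div, abs_mul, abs_of_pos hpos, abs_of_pos Real.pi_pos,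
    div_le_iff₀ Real.pi_pos]
  have h1 := Real.abs_sin_le_one (Real.pi * x)
  have h2 := Real.pi_gt_three
  nlinarith [abs_nonneg (Real.sin (Real.pi * x))]

/-- The power series coefficients of the Wright function. -/
noncomputable def wrightCoeff (a b : ℝ) (k : ℕ) : ℝ :=
  1 / ((k.factorial : ℝ) * Real.Gamma (a * k + b))

theorem wright_eq_tsum (z a b : ℝ) : wright z a b = ∑' k, wrightCoeff a b k * z ^ k := by
  unfold wright wrightCoeff
  exact tsum_congr fun k => by ring

theorem wrightCoeff_succ (a b : ℝ) (k : ℕ) :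
    ((k : ℝ) + 1) * wrightCoeff a b (k + 1) = wrightCoeff a (a + b) k := by
  unfold wrightCoeff
  rw [show a * ((k + 1 : ℕ) : ℝ) + b = a * k + (a + b) by push_cast; ring, Nat.factorial_succ]
  push_cast
  have : (k : ℝ) + 1 ≠ 0 := by positivity
  rw [mul_assoc, one_div, one_div, mul_inv, mul_inv_cancel_left₀ this]

theorem summable_abs_wrightCoeff_mul_pow_of_lt_one {ν b : ℝ} (hν₀ : 0 < ν) (hν₁ : ν < 1)
    (hb : b < 1) (R : ℝ) : Summable fun k => |wrightCoeff (-ν) b k| * |R| ^ k := by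
  refine Summable.of_nonneg_of_le (fun k => by positivity) (fun k => ?_)
    (summable_Gamma_mul_pow_div_factorial hν₀ hν₁ (sub_pos.mpr hb) R)
  have h : -ν * k + b < 1 := by
    have : 0 ≤ ν * k := by positivity
    linarith
  have h1 := abs_one_div_Gamma_le h
  rw [show 1 - (-ν * k + b) = ν * k + (1 - b) by ring] at h1
  unfold wrightCoeff
  rw [← one_div_mul_one_div, abs_mul, abs_of_pos (by positivity : 0 < 1 / (k.factorial : ℝ))]
  calc 1 / (k.factorial : ℝ) * |1 / Real.Gamma (-ν * k + b)| * |R| ^ k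
      ≤ 1 / (k.factorial : ℝ) * Real.Gamma (ν * k + (1 - b)) * |R| ^ k := by gcongr
    _ = _ := by ring

theorem summable_abs_wrightCoeff_mul_pow {ν b : ℝ} (hν₀ : 0 < ν) (hν₁ : ν < 1)
    (hb : b ≤ 1) (R : ℝ) : Summable fun k => |wrightCoeff (-ν) b k| * |R| ^ k := by
  rw [← summable_nat_add_iff 1]
  refine Summable.of_nonneg_of_le (fun k => by positivity) (fun k => ?_)
    ((summable_abs_wrightCoeff_mul_pow_of_lt_one (b := -ν + b) hν₀ hν₁
      (by linarith) R).mul_right |R|)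
  rw [← wrightCoeff_succ, abs_mul, abs_of_pos (by positivity : 0 < (k : ℝ) + 1), pow_succ,
    ← mul_assoc]
  gcongr
  have : (0 : ℝ) ≤ k := by positivity
  nlinarith [abs_nonneg (wrightCoeff (-ν) b (k + 1))]

theorem summable_wrightCoeff_mul_pow {ν b : ℝ} (hν₀ : 0 < ν) (hν₁ : ν < 1)
    (hb : b ≤ 1) (z : ℝ) : Summable fun k => wrightCoeff (-ν) b k * z ^ k := by
  refine Summable.of_norm ?_
  simpa [abs_mul, abs_pow] using summable_abs_wrightCoeff_mul_pow hν₀ hν₁ hb z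

theorem hasDerivAt_wright {ν b : ℝ} (hν₀ : 0 < ν) (hν₁ : ν < 1) (hb : b ≤ 1) (z : ℝ) :
    HasDerivAt (fun z => wright z (-ν) b) (wright z (-ν) (b - ν)) z := by
  have hsum := summable_abs_wrightCoeff_mul_pow (b := b - ν) hν₀ hν₁ (by linarith) (|z| + 1)
  have hterm : ∀ n : ℕ, ∀ y ∈ Metric.ball (0 : ℝ) (|z| + 1),
      HasDerivAt (fun y => wrightCoeff (-ν) b (n + 1) * y ^ (n + 1))
        (wrightCoeff (-ν) (b - ν) n * y ^ n) y := by
    intro n y _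
    have h := (hasDerivAt_pow (n + 1) y).const_mul (wrightCoeff (-ν) b (n + 1))
    refine h.congr_deriv ?_
    rw [show b - ν = -ν + b by ring, ← wrightCoeff_succ]
    rw [Nat.add_sub_cancel]
    push_cast
    ring
  have h := hasDerivAt_tsum_of_isPreconnected hsum Metric.isOpen_ball
    (convex_ball (0 : ℝ) (|z| + 1)).isPreconnected hterm (fun n y hy => ?_) (y₀ := 0)
    (Metric.mem_ball_self (by positivity))
    ((summable_nat_add_iff 1).mpr (summable_wrightCoeff_mul_pow hν₀ hν₁ hb 0))
    (y := z) (by simp)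
  · have hfun : (fun z => wright z (-ν) b) = fun z =>
        wrightCoeff (-ν) b 0 + ∑' k, wrightCoeff (-ν) b (k + 1) * z ^ (k + 1) := by
      funext w
      rw [wright_eq_tsum, (summable_wrightCoeff_mul_pow hν₀ hν₁ hb w).tsum_eq_zero_add]
      simp
    rw [hfun, wright_eq_tsum]
    exact h.const_add _
  · rw [norm_mul, norm_pow, Real.norm_eq_abs, Real.norm_eq_abs]
    have : |y| ≤ |(|z| + 1)| := by
      rw [abs_of_pos (by positivity : 0 < |z| + 1)]
      have := Metric.mem_ball.mp hy
      rw [Real.dist_eq, sub_zero] at this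
      exact this.le
    gcongr

theorem continuous_wright {ν b : ℝ} (hν₀ : 0 < ν) (hν₁ : ν < 1) (hb : b ≤ 1) :
    Continuous fun z => wright z (-ν) b :=
  continuous_iff_continuousAt.mpr fun z => (hasDerivAt_wright hν₀ hν₁ hb z).continuousAt

theorem analyticOnNhd_wright {ν b : ℝ} (hν₀ : 0 < ν) (hν₁ : ν < 1) (hb : b ≤ 1) :
    AnalyticOnNhd ℝ (fun z => wright z (-ν) b) univ := by
  have hr : (FormalMultilinearSeries.ofScalars ℝ (wrightCoeff (-ν) b)).radius = ⊤ := by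
    refine FormalMultilinearSeries.radius_eq_top_of_summable_norm _ fun r => ?_
    simpa [FormalMultilinearSeries.ofScalars_norm] using
      summable_abs_wrightCoeff_mul_pow hν₀ hν₁ hb (r : ℝ)
  have h := (FormalMultilinearSeries.ofScalars ℝ (wrightCoeff (-ν) b)).hasFPowerSeriesOnBall
    (by rw [hr]; exact ENNReal.coe_lt_top)
  rw [hr] at h
  have hfun : (FormalMultilinearSeries.ofScalars ℝ (wrightCoeff (-ν) b)).sum =
      fun z => wright z (-ν) b := by
    funext z
    rw [wright_eq_tsum]
    exact FormalMultilinearSeries.ofScalars_sum_eq _ _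
  rw [hfun] at h
  simpa using h.analyticOnNhd

theorem wright_zero (a b : ℝ) : wright 0 a b = 1 / Real.Gamma b := by
  unfold wright
  rw [tsum_eq_single 0 fun k hk => by simp [hk]]
  simp

/-- The relation `W(z; -ν; 0) = -ν z W(z; -ν; 1 - ν)`. -/
theorem wright_neg_zero_eq {ν : ℝ} (hν₀ : 0 < ν) (hν₁ : ν < 1) (z : ℝ) :
    wright z (-ν) 0 = -(ν * z) * wright z (-ν) (1 - ν) := by
  rw [wright_eq_tsum, wright_eq_tsum, ← tsum_mul_left,
    (summable_wrightCoeff_mul_pow hν₀ hν₁ zero_le_one z).tsum_eq_zero_add]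
  have h0 : wrightCoeff (-ν) 0 0 = 0 := by simp [wrightCoeff, Real.Gamma_zero]
  rw [h0, zero_mul, zero_add]
  refine tsum_congr fun k => ?_
  have h1 := wrightCoeff_succ (-ν) 0 k
  have hk : (k : ℝ) + 1 ≠ 0 := by positivity
  -- `Γ(1 - ν (k + 1)) = -ν (k + 1) Γ(-ν (k + 1))`
  have h2 : wrightCoeff (-ν) (-ν + 0) k = -ν * (k + 1) * wrightCoeff (-ν) (1 - ν) k := by
    unfold wrightCoeff
    have h3 : -ν * (k + 1) ≠ 0 := mul_ne_zero (by linarith) hk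
    have h4 := Real.Gamma_add_one h3
    rw [show -ν * (k : ℝ) + (-ν + 0) = -ν * (k + 1) by ring,
      show -ν * (k : ℝ) + (1 - ν) = -ν * (k + 1) + 1 by ring, h4, ← one_div_mul_one_div,
      ← one_div_mul_one_div, ← one_div_mul_one_div]
    field_simp
  have h5 : wrightCoeff (-ν) 0 (k + 1) = -ν * wrightCoeff (-ν) (1 - ν) k := by
    refine mul_left_cancel₀ hk ?_
    rw [h1, h2]; ring
  rw [h5]; ring

/-! ### The Wright function as a Laplace transform -/

theorem hasSum_pow_div_factorial_mul_sin (x A B : ℝ) :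
    HasSum (fun k : ℕ => x ^ k / (k.factorial : ℝ) * Real.sin (A - k * B))
      (Real.exp (x * Real.cos B) * Real.sin (A - x * Real.sin B)) := by
  have h := NormedSpace.expSeries_div_hasSum_exp
    ((x : ℂ) * Complex.exp (-(B : ℂ) * Complex.I))
  rw [← Complex.exp_eq_exp_ℂ] at h
  have h2 := Complex.hasSum_im (h.mul_left (Complex.exp ((A : ℂ) * Complex.I)))
  have hexp : ∀ y : ℝ, Complex.exp ((y : ℂ) * Complex.I) =
      (Real.cos y : ℂ) + (Real.sin y : ℂ) * Complex.I := fun y => by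
    rw [Complex.exp_mul_I]; push_cast; ring
  convert h2 using 1
  · funext k
    have : Complex.exp (A * Complex.I) * (((x : ℂ) * Complex.exp (-(B : ℂ) * Complex.I)) ^ k /
        (k.factorial : ℂ)) = ((x ^ k / (k.factorial : ℝ) : ℝ) : ℂ) *
        Complex.exp (((A - k * B : ℝ) : ℂ) * Complex.I) := by
      rw [mul_pow, ← Complex.exp_nat_mul]
      rw [show (((A - k * B : ℝ) : ℂ) * Complex.I) =
        (A : ℂ) * Complex.I + k * (-(B : ℂ) * Complex.I) by push_cast; ring, Complex.exp_add]
      push_cast; ring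
    rw [this, Complex.im_ofReal_mul, Complex.exp_ofReal_mul_I_im]
  · have : Complex.exp (A * Complex.I) *
        Complex.exp ((x : ℂ) * Complex.exp (-(B : ℂ) * Complex.I)) =
        ((Real.exp (x * Real.cos B) : ℝ) : ℂ) *
        Complex.exp (((A - x * Real.sin B : ℝ) : ℂ) * Complex.I) := by
      rw [show -(B : ℂ) * Complex.I = ((-B : ℝ) : ℂ) * Complex.I by push_cast; ring, hexp (-B)]
      rw [Complex.ofReal_exp, ← Complex.exp_add, ← Complex.exp_add, Real.cos_neg, Real.sin_neg]
      congr 1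
      push_cast; ring
    rw [this, Complex.im_ofReal_mul, Complex.exp_ofReal_mul_I_im]

/-- The spectral density `r ^ (-b) Im (exp (iπb - c r ^ ν exp (-iπν)))` whose Laplace transform
is `π t ^ (b - 1) W(-c t ^ (-ν); -ν; b)`. -/
noncomputable def wrightDensity (ν b c r : ℝ) : ℝ :=
  r ^ (-b) * (Real.exp (-(c * r ^ ν) * Real.cos (Real.pi * ν)) *
    Real.sin (Real.pi * b - -(c * r ^ ν) * Real.sin (Real.pi * ν)))

/-- Termwise integration of the power series; the reflection formula turns `Γ(1 - b + ν k)` into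
`1 / Γ(b - ν k)`. -/
theorem integral_exp_mul_wrightDensity {ν b : ℝ} (hν₀ : 0 < ν) (hν₁ : ν < 1) (hb : b < 1)
    (c : ℝ) {t : ℝ} (ht : 0 < t) :
    ∫ r in Ioi 0, Real.exp (-(t * r)) * wrightDensity ν b c r =
      Real.pi * (t ^ (b - 1) * wright (-(c * t ^ (-ν))) (-ν) b) := by
  set F : ℕ → ℝ → ℝ := fun k r => ((-c) ^ k / (k.factorial : ℝ) *
    Real.sin (Real.pi * b - k * (Real.pi * ν))) *
      (r ^ ((ν * k + (1 - b)) - 1) * Real.exp (-(t * r))) with hF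
  have ha : ∀ k : ℕ, 0 < ν * k + (1 - b) := fun k => by
    have : 0 ≤ ν * k := by positivity
    linarith
  have hGint : ∀ k : ℕ, IntegrableOn
      (fun r : ℝ => r ^ ((ν * k + (1 - b)) - 1) * Real.exp (-(t * r))) (Ioi 0) := fun k => by
    refine Integrable.of_integral_ne_zero ?_
    rw [Real.integral_rpow_mul_exp_neg_mul_Ioi (ha k) ht]
    have := Real.Gamma_pos_of_pos (ha k)
    positivity
  have hFint : ∀ k, IntegrableOn (F k) (Ioi 0) := fun k => (hGint k).const_mul _
  have hpow : ∀ k : ℕ, (1 / t) ^ (ν * k + (1 - b)) = t ^ (b - 1) * (t ^ (-ν)) ^ k := fun k => by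
    rw [one_div, Real.inv_rpow ht.le, ← Real.rpow_neg ht.le, ← Real.rpow_natCast (t ^ (-ν)),
      ← Real.rpow_mul ht.le, ← Real.rpow_add ht]
    ring_nf
  have hnorm : ∀ k, ∫ r in Ioi 0, ‖F k r‖ = |(-c) ^ k / (k.factorial : ℝ) *
      Real.sin (Real.pi * b - k * (Real.pi * ν))| *
        (t ^ (b - 1) * (t ^ (-ν)) ^ k * Real.Gamma (ν * k + (1 - b))) := fun k => by
    rw [← hpow, ← Real.integral_rpow_mul_exp_neg_mul_Ioi (ha k) ht,
      ← integral_const_mul]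
    refine setIntegral_congr_fun measurableSet_Ioi fun r hr => ?_
    have hr : 0 < r := hr
    rw [hF, norm_mul, Real.norm_eq_abs, Real.norm_of_nonneg (by positivity)]
  have hsum : Summable fun k => ∫ r in Ioi 0, ‖F k r‖ := by
    refine Summable.of_nonneg_of_le (fun k => integral_nonneg fun r => norm_nonneg _)
      (fun k => ?_) ((summable_Gamma_mul_pow_div_factorial hν₀ hν₁ (sub_pos.mpr hb)
        (c * t ^ (-ν))).mul_left (t ^ (b - 1)))
    have hG := Real.Gamma_pos_of_pos (ha k)
    rw [hnorm, abs_mul, abs_div, abs_pow, abs_neg, Nat.abs_cast, abs_mul c,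
      abs_of_pos (by positivity : 0 < t ^ (-ν)), mul_pow]
    calc |c| ^ k / (k.factorial : ℝ) * |Real.sin (Real.pi * b - k * (Real.pi * ν))| *
          (t ^ (b - 1) * (t ^ (-ν)) ^ k * Real.Gamma (ν * k + (1 - b)))
        ≤ |c| ^ k / (k.factorial : ℝ) * 1 *
          (t ^ (b - 1) * (t ^ (-ν)) ^ k * Real.Gamma (ν * k + (1 - b))) := by
          gcongr; exact Real.abs_sin_le_one _
      _ = _ := by ring
  have key := hasSum_integral_of_summable_integral_norm hFint hsum
  have hpt : ∫ r in Ioi 0, Real.exp (-(t * r)) * wrightDensity ν b c r =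
      ∫ r in Ioi 0, ∑' k, F k r := by
    refine setIntegral_congr_fun measurableSet_Ioi fun r hr => ?_
    have hr : 0 < r := hr
    have h := (hasSum_pow_div_factorial_mul_sin (-(c * r ^ ν)) (Real.pi * b)
      (Real.pi * ν)).mul_left (Real.exp (-(t * r)) * r ^ (-b))
    simp only [wrightDensity]
    rw [← mul_assoc, ← h.tsum_eq]
    refine tsum_congr fun k => ?_
    simp only [hF]
    rw [show ν * k + (1 - b) - 1 = -b + ν * k by ring, Real.rpow_add hr, Real.rpow_mul hr.le,
      Real.rpow_natCast, neg_mul_eq_neg_mul c, mul_pow]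
    ring
  rw [hpt, ← key.tsum_eq, wright_eq_tsum, ← tsum_mul_left, ← tsum_mul_left]
  refine tsum_congr fun k => ?_
  rw [hF]
  simp only
  rw [integral_const_mul, Real.integral_rpow_mul_exp_neg_mul_Ioi (ha k) ht, hpow,
    wrightCoeff, ← one_div_mul_one_div, one_div_Gamma_eq_sin_mul (by linarith [ha k]),
    show 1 - (-ν * k + b) = ν * k + (1 - b) by ring,
    show Real.pi * (-ν * k + b) = Real.pi * b - k * (Real.pi * ν) by ring,
    neg_mul_eq_neg_mul c, mul_pow]
  have := Real.pi_ne_zero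
  field_simp

theorem cos_pi_mul_pos {ν : ℝ} (hν₀ : 0 < ν) (hν : ν < 1 / 2) : 0 < Real.cos (Real.pi * ν) :=
  Real.cos_pos_of_mem_Ioo ⟨by nlinarith [Real.pi_pos], by nlinarith [Real.pi_pos]⟩

theorem integrableOn_rpow_mul_exp_neg_mul_rpow_Ioi {q κ ν : ℝ} (hq : -1 < q) (hκ : 0 < κ)
    (hν : 0 < ν) : IntegrableOn (fun r : ℝ => r ^ q * Real.exp (-κ * r ^ ν)) (Ioi 0) := by
  refine Integrable.of_integral_ne_zero ?_
  rw [integral_rpow_mul_exp_neg_mul_rpow hν hq hκ]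
  have : 0 < (q + 1) / ν := div_pos (by linarith) hν
  have := Real.Gamma_pos_of_pos this
  positivity

theorem continuousOn_wrightDensity {ν : ℝ} (hν₀ : 0 < ν) (b c : ℝ) :
    ContinuousOn (wrightDensity ν b c) (Ioi 0) := by
  unfold wrightDensity
  have h : Continuous fun r : ℝ => r ^ ν := Real.continuous_rpow_const hν₀.le
  exact (continuousOn_id.rpow_const fun r hr => Or.inl (ne_of_gt hr)).mul
    (Continuous.continuousOn (by fun_prop))

theorem abs_wrightDensity_le (ν b c : ℝ) {r : ℝ} (hr : 0 < r) :
    |wrightDensity ν b c r| ≤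
      r ^ (-b) * Real.exp (-(c * Real.cos (Real.pi * ν)) * r ^ ν) := by
  unfold wrightDensity
  rw [abs_mul, abs_mul, Real.abs_exp, abs_of_pos (by positivity : 0 < r ^ (-b)),
    show -(c * r ^ ν) * Real.cos (Real.pi * ν) = -(c * Real.cos (Real.pi * ν)) * r ^ ν by ring]
  have := Real.abs_sin_le_one (Real.pi * b - -(c * r ^ ν) * Real.sin (Real.pi * ν))
  calc _ ≤ r ^ (-b) * (Real.exp (-(c * Real.cos (Real.pi * ν)) * r ^ ν) * 1) := by gcongr
    _ = _ := by ring

/-- For `b = 0` the sine vanishes at `r = 0`; the extra factor `r ^ ν` makes the quotient by `r`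
integrable, so that the total mass of `g_0` is finite. -/
theorem abs_wrightDensity_zero_le {ν c : ℝ} (hc : 0 < c) {r : ℝ} (hr : 0 < r) :
    |wrightDensity ν 0 c r| ≤
      c * (r ^ ν * Real.exp (-(c * Real.cos (Real.pi * ν)) * r ^ ν)) := by
  unfold wrightDensity
  rw [abs_mul, abs_mul, Real.abs_exp, abs_of_pos (by positivity : 0 < r ^ (-(0:ℝ))),
    show -(c * r ^ ν) * Real.cos (Real.pi * ν) = -(c * Real.cos (Real.pi * ν)) * r ^ ν by ring]
  have h1 := @Real.abs_sin_le_abs (Real.pi * 0 - -(c * r ^ ν) * Real.sin (Real.pi * ν))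
  have h2 : |Real.pi * 0 - -(c * r ^ ν) * Real.sin (Real.pi * ν)| ≤ c * r ^ ν := by
    rw [mul_zero, zero_sub, neg_mul, neg_neg, abs_mul, abs_of_pos (by positivity : 0 < c * r ^ ν)]
    exact mul_le_of_le_one_right (by positivity) (Real.abs_sin_le_one _)
  rw [neg_zero, Real.rpow_zero, one_mul]
  calc _ ≤ Real.exp (-(c * Real.cos (Real.pi * ν)) * r ^ ν) * (c * r ^ ν) := by
        gcongr; exact h1.trans h2
    _ = _ := by ring

theorem integrableOn_wrightDensity {ν b c : ℝ} (hν₀ : 0 < ν) (hν : ν < 1 / 2) (hb : b < 1)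
    (hc : 0 < c) : IntegrableOn (wrightDensity ν b c) (Ioi 0) := by
  refine (integrableOn_rpow_mul_exp_neg_mul_rpow_Ioi (q := -b) (by linarith)
    (mul_pos hc (cos_pi_mul_pos hν₀ hν)) hν₀).mono'
    ((continuousOn_wrightDensity hν₀ b c).aestronglyMeasurable measurableSet_Ioi) ?_
  exact (ae_restrict_mem measurableSet_Ioi).mono fun r hr =>
    abs_wrightDensity_le ν b c hr

theorem integrableOn_wrightDensity_zero_div {ν c : ℝ} (hν₀ : 0 < ν) (hν : ν < 1 / 2)
    (hc : 0 < c) : IntegrableOn (fun r => wrightDensity ν 0 c r / r) (Ioi 0) := by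
  refine ((integrableOn_rpow_mul_exp_neg_mul_rpow_Ioi (q := ν - 1) (by linarith)
    (mul_pos hc (cos_pi_mul_pos hν₀ hν)) hν₀).const_mul c).mono'
    (((continuousOn_wrightDensity hν₀ 0 c).div continuousOn_id
      fun r hr => ne_of_gt hr).aestronglyMeasurable measurableSet_Ioi) ?_
  refine (ae_restrict_mem measurableSet_Ioi).mono fun r hr => ?_
  have hr : 0 < r := hr
  rw [Real.norm_eq_abs, abs_div, abs_of_pos hr, div_le_iff₀ hr, Real.rpow_sub_one hr.ne']
  calc _ ≤ _ := abs_wrightDensity_zero_le hc hr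
    _ = _ := by field_simp

theorem integrableOn_div_add {φ : ℝ → ℝ} (hφ : IntegrableOn φ (Ioi 0)) {s : ℝ} (hs : 0 < s) :
    IntegrableOn (fun r => φ r / (s + r)) (Ioi 0) := by
  refine (hφ.norm.mul_const s⁻¹).mono' ?_ ?_
  · exact (hφ.aestronglyMeasurable.aemeasurable.div
      (continuous_const.add continuous_id).aemeasurable).aestronglyMeasurable
  · refine (ae_restrict_mem measurableSet_Ioi).mono fun r hr => ?_
    have hr : 0 < r := hr
    rw [norm_div, Real.norm_of_nonneg (by positivity : 0 ≤ s + r), div_eq_mul_inv]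
    gcongr
    linarith

theorem integrable_prod_exp_mul {φ : ℝ → ℝ} {s : ℝ} (hs : 0 ≤ s)
    (hφm : AEStronglyMeasurable φ (volume.restrict (Ioi 0)))
    (hφ : IntegrableOn (fun r => φ r / (s + r)) (Ioi 0)) :
    Integrable
      (fun p : ℝ × ℝ => Real.exp (-((s + p.1) * p.2)) * φ p.1)
      ((volume.restrict (Ioi 0)).prod (volume.restrict (Ioi 0))) := by
  have hint : ∀ r : ℝ, 0 < r → IntegrableOn (fun t : ℝ => Real.exp (-((s + r) * t))) (Ioi 0) ∧
      ∫ t in Ioi 0, Real.exp (-((s + r) * t)) = 1 / (s + r) := by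
    intro r hr
    have hsr : 0 < s + r := by linarith
    have h1 : (fun t : ℝ => Real.exp (-((s + r) * t))) =
        fun t : ℝ => Real.exp (-(s + r) * t) := by funext t; ring_nf
    rw [h1]
    refine ⟨exp_neg_integrableOn_Ioi 0 hsr, ?_⟩
    rw [integral_exp_mul_Ioi (by linarith), mul_zero, Real.exp_zero, neg_div_neg_eq]
  rw [integrable_prod_iff]
  · constructor
    · refine (ae_restrict_mem measurableSet_Ioi).mono fun r hr => ?_
      exact (hint r hr).1.mul_const (φ r)
    · refine hφ.norm.congr ?_
      refine (ae_restrict_mem measurableSet_Ioi).mono fun r hr => ?_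
      have hr : 0 < r := hr
      simp only [norm_mul, Real.norm_eq_abs, Real.abs_exp]
      rw [integral_mul_const, (hint r hr).2, abs_div,
        abs_of_pos (by linarith : 0 < s + r)]
      ring
  · refine AEStronglyMeasurable.mul ?_ hφm.comp_fst
    exact Continuous.aestronglyMeasurable (by fun_prop)

/-- The Laplace transform of a Laplace transform is a Stieltjes transform. -/
theorem integrableOn_exp_mul_laplace {φ : ℝ → ℝ} {s : ℝ} (hs : 0 ≤ s)
    (hφm : AEStronglyMeasurable φ (volume.restrict (Ioi 0)))
    (hφ : IntegrableOn (fun r => φ r / (s + r)) (Ioi 0)) :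
    IntegrableOn (fun t => Real.exp (-(s * t)) * ∫ r in Ioi 0, Real.exp (-(t * r)) * φ r) (Ioi 0) ∧
    ∫ t in Ioi 0, Real.exp (-(s * t)) * ∫ r in Ioi 0, Real.exp (-(t * r)) * φ r =
      ∫ r in Ioi 0, φ r / (s + r) := by
  have hprod := integrable_prod_exp_mul hs hφm hφ
  have heq : ∀ t : ℝ, Real.exp (-(s * t)) * ∫ r in Ioi 0, Real.exp (-(t * r)) * φ r =
      ∫ r in Ioi 0, Real.exp (-((s + r) * t)) * φ r := by
    intro t
    rw [← integral_const_mul]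
    refine integral_congr_ae (Eventually.of_forall fun r => ?_)
    simp only
    rw [← mul_assoc, ← Real.exp_add]
    ring_nf
  simp only [heq]
  refine ⟨hprod.integral_prod_right, ?_⟩
  rw [← integral_integral_swap (f := fun r t => Real.exp (-((s + r) * t)) * φ r)
    hprod]
  refine setIntegral_congr_fun measurableSet_Ioi fun r hr => ?_
  have hr : 0 < r := hr
  rw [integral_mul_const]
  have h1 : (fun t : ℝ => Real.exp (-((s + r) * t))) =
      fun t : ℝ => Real.exp (-(s + r) * t) := by funext t; ring_nf
  rw [h1, integral_exp_mul_Ioi (by linarith), mul_zero, Real.exp_zero, neg_div_neg_eq,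
    one_div_mul_eq_div]

/-! ### The Stieltjes transform of the spectral density -/

/-- Cauchy's theorem on an infinite horizontal strip. -/
theorem integral_horizontal_line_eq {G : ℂ → ℂ} {a b : ℝ} (hab : a ≤ b)
    (hd : DifferentiableOn ℂ G {w | w.im ∈ Icc a b}) {B : ℝ → ℝ}
    (htop : ∀ᶠ x : ℝ in atTop, ∀ y ∈ Icc a b, ‖G (x + y * Complex.I)‖ ≤ B x)
    (hbot : ∀ᶠ x : ℝ in atBot, ∀ y ∈ Icc a b, ‖G (x + y * Complex.I)‖ ≤ B x)
    (hBtop : Tendsto B atTop (𝓝 0)) (hBbot : Tendsto B atBot (𝓝 0))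
    (hia : Integrable fun x : ℝ => G (x + a * Complex.I))
    (hib : Integrable fun x : ℝ => G (x + b * Complex.I)) :
    ∫ x : ℝ, G (x + a * Complex.I) = ∫ x : ℝ, G (x + b * Complex.I) := by
  have hrect : ∀ T : ℝ,
      (∫ x : ℝ in (-T)..T, G (x + a * Complex.I)) - (∫ x : ℝ in (-T)..T, G (x + b * Complex.I)) +
      Complex.I • (∫ y : ℝ in a..b, G (T + y * Complex.I)) -
      Complex.I • (∫ y : ℝ in a..b, G ((-T : ℝ) + y * Complex.I)) = 0 := by
    intro T
    have h := Complex.integral_boundary_rect_eq_zero_of_differentiableOn G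
      ((-T : ℝ) + a * Complex.I) (T + b * Complex.I) (hd.mono ?_)
    · simpa using h
    · intro w hw
      have hw2 := hw.2
      simp only [Complex.add_im, Complex.ofReal_im, Complex.mul_im, Complex.ofReal_re,
        Complex.I_im, Complex.I_re, mul_one, mul_zero, add_zero, zero_add, uIcc_of_le hab] at hw2
      exact hw2
  have hvert : ∀ {l : Filter ℝ} {σ : ℝ → ℝ} {m : Filter ℝ}, Tendsto σ l m →
      (∀ᶠ x : ℝ in m, ∀ y ∈ Icc a b, ‖G (x + y * Complex.I)‖ ≤ B x) → Tendsto B m (𝓝 0) →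
      Tendsto (fun T => Complex.I • ∫ y : ℝ in a..b, G ((σ T : ℝ) + y * Complex.I)) l (𝓝 0) := by
    intro l σ m hσ hm hB
    have hlim : Tendsto (fun T => B (σ T) * |b - a|) l (𝓝 0) := by
      simpa using (hB.comp hσ).mul_const |b - a|
    refine squeeze_zero_norm' ?_ hlim
    filter_upwards [hσ.eventually hm] with T hT
    rw [norm_smul, Complex.norm_I, one_mul]
    refine intervalIntegral.norm_integral_le_of_norm_le_const fun y hy => hT y ?_
    rw [uIoc_of_le hab] at hy
    exact Ioc_subset_Icc_self hy
  have hA := intervalIntegral_tendsto_integral hia tendsto_neg_atTop_atBot tendsto_id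
  have hB := intervalIntegral_tendsto_integral hib tendsto_neg_atTop_atBot tendsto_id
  have hlim := ((hA.sub hB).add (hvert tendsto_id htop hBtop)).sub
    (hvert tendsto_neg_atTop_atBot hbot hBbot)
  have h0 := tendsto_nhds_unique (hlim.congr fun T => hrect T) tendsto_const_nhds
  rw [add_zero, sub_zero] at h0
  exact sub_eq_zero.mp h0

theorem integrable_comp_exp_iff {f : ℝ → ℝ} :
    Integrable (fun x => f (Real.exp x) * Real.exp x) ↔ IntegrableOn f (Ioi 0) := by
  have h := integrableOn_image_iff_integrableOn_abs_deriv_smul (f := Real.exp) (f' := Real.exp)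
    (s := univ) MeasurableSet.univ (fun x _ => (Real.hasDerivAt_exp x).hasDerivWithinAt)
    Real.exp_injective.injOn f
  rw [image_univ, Real.range_exp] at h
  rw [h, integrableOn_univ]
  simp only [Real.abs_exp, smul_eq_mul, mul_comm]

theorem integral_comp_exp_mul_exp (f : ℝ → ℝ) :
    ∫ x, f (Real.exp x) * Real.exp x = ∫ r in Ioi 0, f r := by
  have h := integral_image_eq_integral_abs_deriv_smul (f := Real.exp) (f' := Real.exp)
    (s := univ) MeasurableSet.univ (fun x _ => (Real.hasDerivAt_exp x).hasDerivWithinAt)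
    Real.exp_injective.injOn f
  rw [image_univ, Real.range_exp] at h
  rw [h, Measure.restrict_univ]
  simp only [Real.abs_exp, smul_eq_mul, mul_comm]

theorem integral_inv_sqrt_div_add {s : ℝ} (hs : 0 < s) :
    IntegrableOn (fun r => (√r)⁻¹ / (s + r)) (Ioi 0) ∧
      ∫ r in Ioi 0, (√r)⁻¹ / (s + r) = Real.pi / √s := by
  have hss : 0 < √s := Real.sqrt_pos.mpr hs
  have hcont : ContinuousWithinAt (fun r => 2 / √s * Real.arctan (√r / √s)) (Ici 0) 0 :=
    Continuous.continuousWithinAt (by fun_prop)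
  have hderiv : ∀ r ∈ Ioi (0 : ℝ), HasDerivAt (fun r => 2 / √s * Real.arctan (√r / √s))
      ((√r)⁻¹ / (s + r)) r := by
    intro r hr
    have hr : 0 < r := hr
    have hsr : 0 < √r := Real.sqrt_pos.mpr hr
    have h := (((Real.hasDerivAt_sqrt hr.ne').div_const (√s)).arctan).const_mul (2 / √s)
    refine h.congr_deriv ?_
    have h1 : (√r) ^ 2 = r := Real.sq_sqrt hr.le
    have h2 : (√s) ^ 2 = s := Real.sq_sqrt hs.le
    rw [div_pow, h1, h2]
    field_simp
    rw [h2]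
  have hpos : ∀ r ∈ Ioi (0 : ℝ), 0 ≤ (√r)⁻¹ / (s + r) := fun r hr => by
    have hr : 0 < r := hr
    positivity
  have hlim : Tendsto (fun r => 2 / √s * Real.arctan (√r / √s)) atTop
      (𝓝 (2 / √s * (Real.pi / 2))) := by
    refine Tendsto.const_mul _ ?_
    have h1 : Tendsto Real.arctan atTop (𝓝 (Real.pi / 2)) :=
      Real.tendsto_arctan_atTop.mono_right nhdsWithin_le_nhds
    exact h1.comp (Real.tendsto_sqrt_atTop.atTop_div_const hss)
  refine ⟨integrableOn_Ioi_deriv_of_nonneg hcont hderiv hpos hlim, ?_⟩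
  rw [integral_Ioi_of_hasDerivAt_of_nonneg hcont hderiv hpos hlim]
  rw [Real.sqrt_zero, zero_div, Real.arctan_zero]
  ring

/-- In the logarithmic variable `w = log z`, the function `exp (-c z ^ ν) z ^ (-b)` minus the
multiple of `z ^ (-1/2)` that makes the difference vanish at `z = exp x₀`. -/
noncomputable def stripNumerator (ν b c x₀ : ℝ) (w : ℂ) : ℂ :=
  Complex.exp (-c * Complex.exp (ν * w) - b * w) -
    Complex.exp (-c * Complex.exp (ν * x₀) - b * x₀) * Complex.exp (-(w - x₀) / 2)

/-- The integrand `stripNumerator w * exp w / (exp x₀ - exp w)`, with the singularity at `x₀`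
removed by difference quotients. -/
noncomputable def stripIntegrand (ν b c x₀ : ℝ) (w : ℂ) : ℂ :=
  -(dslope (stripNumerator ν b c x₀) x₀ w * Complex.exp w / dslope Complex.exp x₀ w)

theorem differentiable_stripNumerator (ν b c x₀ : ℝ) :
    Differentiable ℂ (stripNumerator ν b c x₀) := by
  unfold stripNumerator
  fun_prop

theorem differentiable_dslope {f : ℂ → ℂ} (hf : Differentiable ℂ f) (a : ℂ) :
    Differentiable ℂ (dslope f a) := by
  rw [← differentiableOn_univ] at hf ⊢
  exact (Complex.differentiableOn_dslope univ_mem).mpr hf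

theorem exp_ne_exp_ofReal {w : ℂ} {x₀ : ℝ} (hw : w.im ∈ Icc (-Real.pi) Real.pi) (hne : w ≠ x₀) :
    Complex.exp w ≠ Complex.exp x₀ := by
  intro h
  obtain ⟨n, hn⟩ := Complex.exp_eq_exp_iff_exists_int.mp h
  have him : w.im = n * (2 * Real.pi) := by
    rw [hn]; simp
  have hn0 : n = 0 := by
    rw [him] at hw
    have h1 : (-1 : ℝ) < n := by nlinarith [hw.1, Real.pi_pos]
    have h2 : (n : ℝ) < 1 := by nlinarith [hw.2, Real.pi_pos]
    have h3 : -1 < n := by exact_mod_cast h1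
    have h4 : n < 1 := by exact_mod_cast h2
    omega
  rw [hn0] at hn
  exact hne (by simpa using hn)

theorem dslope_exp_ne_zero {w : ℂ} {x₀ : ℝ} (hw : w.im ∈ Icc (-Real.pi) Real.pi) :
    dslope Complex.exp x₀ w ≠ 0 := by
  by_cases hne : w = x₀
  · rw [hne, dslope_same, Complex.deriv_exp]
    exact Complex.exp_ne_zero _
  · rw [dslope_of_ne _ hne, slope_def_field]
    exact div_ne_zero (sub_ne_zero.mpr (exp_ne_exp_ofReal hw hne)) (sub_ne_zero.mpr hne)

theorem differentiableOn_stripIntegrand (ν b c x₀ : ℝ) :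
    DifferentiableOn ℂ (stripIntegrand ν b c x₀) {w | w.im ∈ Icc (-Real.pi) Real.pi} := by
  unfold stripIntegrand
  refine (DifferentiableOn.div ?_ ?_ fun w hw => dslope_exp_ne_zero hw).neg
  · exact ((differentiable_dslope (differentiable_stripNumerator ν b c x₀) _).mul
      Complex.differentiable_exp).differentiableOn
  · exact (differentiable_dslope Complex.differentiable_exp _).differentiableOn

theorem stripIntegrand_eq {ν b c x₀ : ℝ} {w : ℂ} (hne : w ≠ x₀) :
    stripIntegrand ν b c x₀ w =
      stripNumerator ν b c x₀ w * Complex.exp w / (Complex.exp x₀ - Complex.exp w) := by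
  have h0 : stripNumerator ν b c x₀ x₀ = 0 := by simp [stripNumerator]
  have h1 := sub_ne_zero.mpr hne
  unfold stripIntegrand
  rw [dslope_of_ne _ hne, dslope_of_ne _ hne, slope_def_field, slope_def_field, h0, sub_zero,
    div_mul_eq_mul_div, div_div_div_cancel_right₀ h1, ← div_neg, neg_sub]

theorem norm_stripNumerator_le {ν b c x₀ : ℝ} (hν₀ : 0 < ν) (hν : ν < 1 / 2) (hc : 0 < c)
    (x : ℝ) {y : ℝ} (hy : y ∈ Icc (-Real.pi) Real.pi) :
    ‖stripNumerator ν b c x₀ (x + y * Complex.I)‖ ≤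
      (Real.exp x) ^ (-b) * Real.exp (-(c * Real.cos (Real.pi * ν)) * (Real.exp x) ^ ν) +
      Real.exp (-c * Real.exp (ν * x₀) - b * x₀ + x₀ / 2) * (√(Real.exp x))⁻¹ := by
  unfold stripNumerator
  refine (norm_sub_le _ _).trans (add_le_add ?_ (le_of_eq ?_))
  · rw [Complex.norm_exp]
    have hre : (-(c : ℂ) * Complex.exp (ν * (x + y * Complex.I)) - b * (x + y * Complex.I)).re =
        -(b * x) + -(c * Real.cos (ν * y)) * Real.exp (ν * x) := by
      rw [show (ν : ℂ) * (x + y * Complex.I) = ((ν * x : ℝ) : ℂ) + ((ν * y : ℝ) : ℂ) * Complex.I by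
        push_cast; ring, Complex.exp_add, Complex.exp_mul_I,
        show -(c : ℂ) * (Complex.exp ((ν * x : ℝ) : ℂ) * (Complex.cos ((ν * y : ℝ) : ℂ) +
          Complex.sin ((ν * y : ℝ) : ℂ) * Complex.I)) - b * (x + y * Complex.I) =
          ((-(b * x) + -(c * Real.cos (ν * y)) * Real.exp (ν * x) : ℝ) : ℂ) +
          ((-(c * Real.exp (ν * x) * Real.sin (ν * y)) - b * y : ℝ) : ℂ) * Complex.I by
          push_cast; ring]
      rw [Complex.add_re, Complex.ofReal_re, Complex.re_ofReal_mul, Complex.I_re, mul_zero,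
        add_zero]
    rw [hre, Real.exp_add, ← Real.exp_mul, ← Real.exp_mul]
    have hcos : Real.cos (Real.pi * ν) ≤ Real.cos (ν * y) := by
      rw [← Real.cos_abs (ν * y), abs_mul, abs_of_pos hν₀, mul_comm Real.pi]
      have hy' : |y| ≤ Real.pi := abs_le.mpr hy
      exact Real.cos_le_cos_of_nonneg_of_le_pi (by positivity)
        (by nlinarith [Real.pi_pos]) (by gcongr)
    rw [show x * -b = -(b * x) by ring, show x * ν = ν * x by ring]
    gcongr
  · rw [norm_mul, Complex.norm_exp, Complex.norm_exp]
    have h1 : (-(c : ℂ) * Complex.exp (ν * x₀) - b * x₀).re =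
        -c * Real.exp (ν * x₀) - b * x₀ := by
      rw [← Complex.ofReal_re (-c * Real.exp (ν * x₀) - b * x₀)]
      push_cast
      rfl
    have h2 : (-((x : ℂ) + y * Complex.I - x₀) / 2).re = x₀ / 2 + -(x / 2) := by
      rw [show (-((x : ℂ) + y * Complex.I - x₀) / 2) =
        ((x₀ / 2 - x / 2 : ℝ) : ℂ) + ((-(y / 2) : ℝ) : ℂ) * Complex.I by push_cast; ring]
      simp
      ring
    have h3 : √(Real.exp x) = Real.exp (x / 2) := by
      rw [Real.sqrt_eq_iff_eq_sq (by positivity) (by positivity), ← Real.exp_nat_mul]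
      congr 1; push_cast; ring
    rw [h1, h2, h3, Real.exp_add, Real.exp_add, ← Real.exp_neg]
    ring

/-- The majorant of `stripIntegrand` as a function of `r = exp (Re w)`. -/
noncomputable def stripMajorant (ν b c K s r : ℝ) : ℝ :=
  (r ^ (-b) * Real.exp (-(c * Real.cos (Real.pi * ν)) * r ^ ν) + K * (√r)⁻¹) / (s + r)

theorem norm_stripIntegrand_le {ν b c x₀ : ℝ} (hν₀ : 0 < ν) (hν : ν < 1 / 2) (hc : 0 < c)
    {x : ℝ} {y κ : ℝ} (hκ : 0 < κ) (hy : y ∈ Icc (-Real.pi) Real.pi)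
    (hden : (Real.exp x₀ + Real.exp x) / κ ≤
      ‖Complex.exp x₀ - Complex.exp (x + y * Complex.I)‖) :
    ‖stripIntegrand ν b c x₀ (x + y * Complex.I)‖ ≤
      κ * (stripMajorant ν b c (Real.exp (-c * Real.exp (ν * x₀) - b * x₀ + x₀ / 2))
        (Real.exp x₀) (Real.exp x) * Real.exp x) := by
  have hne : (x + y * Complex.I) ≠ x₀ := by
    intro h
    rw [h, sub_self, norm_zero] at hden
    have : 0 < (Real.exp x₀ + Real.exp x) / κ := by positivity
    linarith
  rw [stripIntegrand_eq hne, norm_div, norm_mul]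
  have h1 := norm_stripNumerator_le (b := b) (x₀ := x₀) hν₀ hν hc x hy
  have h2 : ‖Complex.exp (x + y * Complex.I)‖ = Real.exp x := by
    rw [Complex.norm_exp]; simp
  rw [h2]
  unfold stripMajorant
  have hpos : 0 < (Real.exp x₀ + Real.exp x) / κ := by positivity
  calc _ ≤ (Real.exp x ^ (-b) *
        Real.exp (-(c * Real.cos (Real.pi * ν)) * Real.exp x ^ ν) +
        Real.exp (-c * Real.exp (ν * x₀) - b * x₀ + x₀ / 2) * (√(Real.exp x))⁻¹) * Real.exp x /
        ((Real.exp x₀ + Real.exp x) / κ) := by gcongr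
    _ = _ := by field_simp

theorem integrableOn_stripMajorant {ν b c K s : ℝ} (hν₀ : 0 < ν) (hν : ν < 1 / 2) (hc : 0 < c)
    (hb : b < 1) (hs : 0 < s) : IntegrableOn (stripMajorant ν b c K s) (Ioi 0) := by
  have h1 := integrableOn_div_add (integrableOn_rpow_mul_exp_neg_mul_rpow_Ioi (q := -b)
    (by linarith) (mul_pos hc (cos_pi_mul_pos hν₀ hν)) hν₀) hs
  refine (h1.add ((integral_inv_sqrt_div_add hs).1.const_mul K)).congr
    (Eventually.of_forall fun r => ?_)
  simp only [stripMajorant, Pi.add_apply]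
  ring

theorem tendsto_stripMajorant_mul_atTop {ν b c K s : ℝ} (hν₀ : 0 < ν) (hν : ν < 1 / 2)
    (hc : 0 < c) (hK : 0 ≤ K) (hs : 0 < s) :
    Tendsto (fun r => stripMajorant ν b c K s r * r) atTop (𝓝 0) := by
  have hκ := mul_pos hc (cos_pi_mul_pos hν₀ hν)
  have h1 : Tendsto (fun r : ℝ => r ^ (-b) * Real.exp (-(c * Real.cos (Real.pi * ν)) * r ^ ν))
      atTop (𝓝 0) := by
    refine ((tendsto_rpow_mul_exp_neg_mul_atTop_nhds_zero (-b / ν) _ hκ).comp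
      (tendsto_rpow_atTop hν₀)).congr' ?_
    filter_upwards [eventually_gt_atTop 0] with r hr
    simp only [Function.comp_apply]
    rw [← Real.rpow_mul hr.le, mul_div_cancel₀ _ hν₀.ne']
  have h2 : Tendsto (fun r : ℝ => K * (√r)⁻¹) atTop (𝓝 0) := by
    simpa using (Real.tendsto_sqrt_atTop.inv_tendsto_atTop).const_mul K
  have h3 := h1.add h2
  rw [add_zero] at h3
  refine squeeze_zero' ?_ ?_ h3
  · filter_upwards [eventually_gt_atTop 0] with r hr
    unfold stripMajorant
    positivity
  · filter_upwards [eventually_gt_atTop 0] with r hr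
    unfold stripMajorant
    rw [div_mul_eq_mul_div, div_le_iff₀ (by positivity)]
    gcongr
    linarith

theorem tendsto_stripMajorant_mul_zero {ν b c K s : ℝ} (hν₀ : 0 < ν) (hν : ν < 1 / 2)
    (hc : 0 < c) (hb : b < 1) (hK : 0 ≤ K) (hs : 0 < s) :
    Tendsto (fun r => stripMajorant ν b c K s r * r) (𝓝[>] 0) (𝓝 0) := by
  have hκ := mul_pos hc (cos_pi_mul_pos hν₀ hν)
  have h : Tendsto (fun r : ℝ => (r ^ (1 - b) + K * √r) / s) (𝓝[>] 0) (𝓝 0) := by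
    have hcont : ContinuousAt (fun r : ℝ => (r ^ (1 - b) + K * √r) / s) 0 := by
      have : ContinuousAt (fun r : ℝ => r ^ (1 - b)) 0 :=
        Real.continuousAt_rpow_const _ _ (Or.inr (by linarith))
      fun_prop
    have h0 := hcont.tendsto
    rw [Real.zero_rpow (by linarith), Real.sqrt_zero, mul_zero, add_zero, zero_div] at h0
    exact h0.mono_left nhdsWithin_le_nhds
  refine squeeze_zero' ?_ ?_ h
  · filter_upwards [self_mem_nhdsWithin] with r hr
    have hr : 0 < r := hr
    unfold stripMajorant
    positivity
  · filter_upwards [self_mem_nhdsWithin] with r hr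
    have hr : 0 < r := hr
    have hsq : √r * √r = r := Real.mul_self_sqrt hr.le
    have hsr : 0 < √r := Real.sqrt_pos.mpr hr
    unfold stripMajorant
    have h1 : Real.exp (-(c * Real.cos (Real.pi * ν)) * r ^ ν) ≤ 1 := by
      rw [Real.exp_le_one_iff, neg_mul, neg_nonpos]
      positivity
    calc (r ^ (-b) * Real.exp (-(c * Real.cos (Real.pi * ν)) * r ^ ν) + K * (√r)⁻¹) / (s + r) * r
        ≤ (r ^ (-b) * 1 + K * (√r)⁻¹) / s * r := by gcongr; linarith
      _ = _ := by
        rw [sub_eq_add_neg, Real.rpow_add hr, Real.rpow_one]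
        have : (√r)⁻¹ * r = √r := by field_simp; linarith
        field_simp
        linear_combination -K * hsq

theorem le_norm_exp_sub_exp {x₀ x : ℝ} (y : ℝ)
    (hx : 3 * Real.exp x₀ ≤ Real.exp x ∨ 3 * Real.exp x ≤ Real.exp x₀) :
    (Real.exp x₀ + Real.exp x) / 2 ≤ ‖Complex.exp x₀ - Complex.exp (x + y * Complex.I)‖ := by
  have h1 : ‖Complex.exp (x + y * Complex.I)‖ = Real.exp x := by
    rw [Complex.norm_exp]; simp
  have h2 : ‖Complex.exp x₀‖ = Real.exp x₀ := by
    rw [Complex.norm_exp]; simp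
  have h3 := abs_norm_sub_norm_le (Complex.exp x₀) (Complex.exp (x + y * Complex.I))
  rw [h1, h2] at h3
  have h4 := abs_le.mp (le_refl |Real.exp x₀ - Real.exp x|)
  rcases hx with hx | hx
  · linarith [h4.1]
  · linarith [h4.2]

theorem stripNumerator_conj (ν b c x₀ : ℝ) (w : ℂ) :
    stripNumerator ν b c x₀ ((starRingEnd ℂ) w) =
      (starRingEnd ℂ) (stripNumerator ν b c x₀ w) := by
  unfold stripNumerator
  simp only [map_sub, map_mul, ← Complex.exp_conj, map_neg, Complex.conj_ofReal, map_div₀,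
    map_ofNat]

theorem stripNumerator_im (ν b c x₀ x : ℝ) :
    (stripNumerator ν b c x₀ (x + (-Real.pi : ℝ) * Complex.I)).im =
      wrightDensity ν b c (Real.exp x) -
      Real.exp (-c * Real.exp (ν * x₀) - b * x₀ + x₀ / 2) * (√(Real.exp x))⁻¹ := by
  have h1 : -(c : ℂ) * Complex.exp (ν * (x + (-Real.pi : ℝ) * Complex.I)) -
      b * (x + (-Real.pi : ℝ) * Complex.I) =
      ((-(b * x) + -(c * Real.exp (ν * x)) * Real.cos (Real.pi * ν) : ℝ) : ℂ) +
      ((Real.pi * b - -(c * Real.exp (ν * x)) * Real.sin (Real.pi * ν) : ℝ) : ℂ) *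
        Complex.I := by
    rw [show (ν : ℂ) * (x + (-Real.pi : ℝ) * Complex.I) =
      ((ν * x : ℝ) : ℂ) + ((-(Real.pi * ν) : ℝ) : ℂ) * Complex.I by push_cast; ring,
      Complex.exp_add, Complex.exp_mul_I, ← Complex.ofReal_cos, ← Complex.ofReal_sin,
      Real.cos_neg, Real.sin_neg]
    push_cast
    ring
  have h2 : Complex.exp (-(c : ℂ) * Complex.exp (ν * x₀) - b * x₀) *
      Complex.exp (-((x : ℂ) + (-Real.pi : ℝ) * Complex.I - x₀) / 2) =
      ((Real.exp (-c * Real.exp (ν * x₀) - b * x₀ + x₀ / 2 + -(x / 2)) : ℝ) : ℂ) * Complex.I := by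
    rw [← Complex.exp_add, show -(c : ℂ) * Complex.exp (ν * x₀) - b * x₀ +
      -((x : ℂ) + (-Real.pi : ℝ) * Complex.I - x₀) / 2 =
      ((-c * Real.exp (ν * x₀) - b * x₀ + x₀ / 2 + -(x / 2) : ℝ) : ℂ) +
        (Real.pi / 2 : ℂ) * Complex.I by push_cast; ring, Complex.exp_add,
      Complex.exp_pi_div_two_mul_I, Complex.ofReal_exp]
  have h3 : √(Real.exp x) = Real.exp (x / 2) := by
    rw [Real.sqrt_eq_iff_eq_sq (by positivity) (by positivity), ← Real.exp_nat_mul]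
    congr 1; push_cast; ring
  unfold stripNumerator wrightDensity
  rw [h1, h2, Complex.sub_im, Complex.exp_add, ← Complex.ofReal_exp, Complex.im_ofReal_mul,
    Complex.exp_ofReal_mul_I_im, Complex.im_ofReal_mul, Complex.I_im, mul_one, Real.exp_add,
    Real.exp_add _ (-(x / 2)), h3, ← Real.exp_neg, ← Real.exp_mul, ← Real.exp_mul,
    show x * -b = -(b * x) by ring, show x * ν = ν * x by ring]
  ring

theorem exp_add_pi_mul_I {σ : ℝ} (hσ : σ = Real.pi ∨ σ = -Real.pi) (x : ℝ) :
    Complex.exp (x + σ * Complex.I) = -(Real.exp x : ℂ) := by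
  rw [Complex.exp_add, Complex.ofReal_exp]
  rcases hσ with rfl | rfl
  · rw [Complex.exp_pi_mul_I]; ring
  · rw [Complex.ofReal_neg, neg_mul, Complex.exp_neg, Complex.exp_pi_mul_I, inv_neg, inv_one]
    ring

theorem stripIntegrand_boundary (ν b c x₀ : ℝ) {σ : ℝ} (hσ : σ = Real.pi ∨ σ = -Real.pi) (x : ℝ) :
    stripIntegrand ν b c x₀ (x + σ * Complex.I) =
      ((-Real.exp x / (Real.exp x₀ + Real.exp x) : ℝ) : ℂ) *
        stripNumerator ν b c x₀ (x + σ * Complex.I) := by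
  have hne : (x + σ * Complex.I) ≠ x₀ := by
    intro h
    have := congrArg Complex.im h
    simp at this
    rcases hσ with rfl | rfl
    · exact Real.pi_ne_zero this
    · exact Real.pi_ne_zero (neg_eq_zero.mp this)
  rw [stripIntegrand_eq hne, exp_add_pi_mul_I hσ, sub_neg_eq_add]
  push_cast
  ring

theorem pi_mem_Icc {σ : ℝ} (hσ : σ = Real.pi ∨ σ = -Real.pi) : σ ∈ Icc (-Real.pi) Real.pi := by
  have := Real.pi_pos
  rcases hσ with rfl | rfl <;> constructor <;> linarith

theorem integrable_stripIntegrand {ν b c : ℝ} (hν₀ : 0 < ν) (hν : ν < 1 / 2) (hc : 0 < c)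
    (hb : b < 1) (x₀ : ℝ) {σ : ℝ} (hσ : σ = Real.pi ∨ σ = -Real.pi) :
    Integrable fun x : ℝ => stripIntegrand ν b c x₀ (x + σ * Complex.I) := by
  have hdom := integrable_comp_exp_iff.mpr (integrableOn_stripMajorant (b := b)
    (K := Real.exp (-c * Real.exp (ν * x₀) - b * x₀ + x₀ / 2)) hν₀ hν hc hb (Real.exp_pos x₀))
  refine (hdom.const_mul 1).mono' (Continuous.aestronglyMeasurable ?_)
    (Eventually.of_forall fun x => norm_stripIntegrand_le hν₀ hν hc one_pos (pi_mem_Icc hσ) ?_)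
  · refine (differentiableOn_stripIntegrand ν b c x₀).continuousOn.comp_continuous
      (by fun_prop) fun x => ?_
    simpa using pi_mem_Icc hσ
  · rw [exp_add_pi_mul_I hσ, div_one, sub_neg_eq_add, ← Complex.ofReal_exp, ← Complex.ofReal_add,
      Complex.norm_real]
    exact le_abs_self _

/-- The Stieltjes transform of the spectral density. Shifting the line of integration across the
strip `|Im w| ≤ π` shows that the integral over the line `Im w = -π` equals its own complex
conjugate, so that its imaginary part vanishes. -/
theorem integral_wrightDensity_div_add {ν b c : ℝ} (hν₀ : 0 < ν) (hν : ν < 1 / 2) (hc : 0 < c)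
    (hb : b < 1) {s : ℝ} (hs : 0 < s) :
    ∫ r in Ioi 0, wrightDensity ν b c r / (s + r) =
      Real.pi * (s ^ (-b) * Real.exp (-(c * s ^ ν))) := by
  set x₀ := Real.log s with hx₀
  have hexp : Real.exp x₀ = s := Real.exp_log hs
  set K := Real.exp (-c * Real.exp (ν * x₀) - b * x₀ + x₀ / 2) with hK
  have hKpos : 0 ≤ K := (Real.exp_pos _).le
  have hpi := Real.pi_pos
  have hshift := integral_horizontal_line_eq (G := stripIntegrand ν b c x₀) (a := -Real.pi)
    (b := Real.pi) (by linarith) (differentiableOn_stripIntegrand ν b c x₀)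
    (B := fun x => 2 * (stripMajorant ν b c K (Real.exp x₀) (Real.exp x) * Real.exp x)) ?_ ?_ ?_ ?_
    (integrable_stripIntegrand hν₀ hν hc hb x₀ (Or.inr rfl))
    (integrable_stripIntegrand hν₀ hν hc hb x₀ (Or.inl rfl))
  · have hconj : ∀ x : ℝ, stripIntegrand ν b c x₀ (x + Real.pi * Complex.I) =
        (starRingEnd ℂ) (stripIntegrand ν b c x₀ (x + (-Real.pi : ℝ) * Complex.I)) := by
      intro x
      rw [stripIntegrand_boundary _ _ _ _ (Or.inl rfl),
        stripIntegrand_boundary _ _ _ _ (Or.inr rfl), map_mul, Complex.conj_ofReal,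
        ← stripNumerator_conj]
      congr 2
      simp
    have him : (∫ x : ℝ, stripIntegrand ν b c x₀ (x + (-Real.pi : ℝ) * Complex.I)).im = 0 := by
      have h1 := integral_conj (μ := volume)
        (f := fun x : ℝ => stripIntegrand ν b c x₀ (x + (-Real.pi : ℝ) * Complex.I))
      simp only [← hconj] at h1
      rw [← hshift] at h1
      exact Complex.conj_eq_iff_im.mp h1.symm
    have h2 := integral_im (𝕜 := ℂ) (integrable_stripIntegrand hν₀ hν hc hb x₀ (Or.inr rfl))
    simp only [RCLike.im_eq_complex_im] at h2
    rw [him] at h2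
    have h3 : ∀ x : ℝ, (stripIntegrand ν b c x₀ (x + (-Real.pi : ℝ) * Complex.I)).im =
        (fun r => -(wrightDensity ν b c r / (s + r) - K * ((√r)⁻¹ / (s + r)))) (Real.exp x) *
          Real.exp x := by
      intro x
      rw [stripIntegrand_boundary _ _ _ _ (Or.inr rfl), Complex.im_ofReal_mul, stripNumerator_im,
        hexp]
      ring
    simp only [h3] at h2
    rw [integral_comp_exp_mul_exp
      (fun r => -(wrightDensity ν b c r / (s + r) - K * ((√r)⁻¹ / (s + r)))),
      integral_neg, integral_sub (integrableOn_div_add (integrableOn_wrightDensity hν₀ hν hb hc) hs)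
        ((integral_inv_sqrt_div_add hs).1.const_mul K), integral_const_mul,
      (integral_inv_sqrt_div_add hs).2, neg_eq_zero, sub_eq_zero] at h2
    rw [h2, hK, Real.exp_add, sub_eq_add_neg, Real.exp_add]
    have hsq : Real.exp (x₀ / 2) = √s := by
      rw [eq_comm, Real.sqrt_eq_iff_eq_sq hs.le (by positivity), ← Real.exp_nat_mul, ← hexp]
      congr 1; push_cast; ring
    have hp1 : Real.exp (ν * x₀) = s ^ ν := by
      rw [Real.rpow_def_of_pos hs, mul_comm]
    have hp2 : Real.exp (-(b * x₀)) = s ^ (-b) := by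
      rw [Real.rpow_def_of_pos hs, ← hx₀]; ring_nf
    have hss : √s ≠ 0 := (Real.sqrt_pos.mpr hs).ne'
    rw [hsq, hp1, hp2, neg_mul]
    field_simp
  · filter_upwards [Real.tendsto_exp_atTop.eventually_ge_atTop (3 * Real.exp x₀)] with x hx y hy
    exact norm_stripIntegrand_le hν₀ hν hc two_pos hy (le_norm_exp_sub_exp y (Or.inl hx))
  · have h : ∀ᶠ x in atBot, Real.exp x < Real.exp x₀ / 3 :=
      Real.tendsto_exp_atBot.eventually (gt_mem_nhds (by positivity))
    filter_upwards [h] with x hx y hy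
    exact norm_stripIntegrand_le hν₀ hν hc two_pos hy
      (le_norm_exp_sub_exp y (Or.inr (by linarith)))
  · simpa using ((tendsto_stripMajorant_mul_atTop hν₀ hν hc hKpos (Real.exp_pos x₀)).comp
      Real.tendsto_exp_atTop).const_mul 2
  · simpa using ((tendsto_stripMajorant_mul_zero hν₀ hν hc hb hKpos (Real.exp_pos x₀)).comp
      Real.tendsto_exp_atBot_nhdsGT).const_mul 2

/-- The self-similar function `t ^ (b - 1) W(-c t ^ (-ν); -ν; b)`, whose Laplace transform is
`s ^ (-b) exp (-c s ^ ν)`. -/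
noncomputable def wrightTime (ν b c t : ℝ) : ℝ :=
  t ^ (b - 1) * wright (-(c * t ^ (-ν))) (-ν) b

theorem wrightTime_eq_laplace {ν b : ℝ} (hν₀ : 0 < ν) (hν₁ : ν < 1) (hb : b < 1)
    (c : ℝ) {t : ℝ} (ht : 0 < t) :
    wrightTime ν b c t =
      Real.pi⁻¹ * ∫ r in Ioi 0, Real.exp (-(t * r)) * wrightDensity ν b c r := by
  rw [integral_exp_mul_wrightDensity hν₀ hν₁ hb c ht, wrightTime,
    inv_mul_cancel_left₀ Real.pi_ne_zero]

theorem laplace_wrightTime {ν b c : ℝ} (hν₀ : 0 < ν) (hν : ν < 1 / 2) (hc : 0 < c)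
    (hb : b < 1) {s : ℝ} (hs : 0 < s) :
    IntegrableOn (fun t => Real.exp (-(s * t)) * wrightTime ν b c t) (Ioi 0) ∧
    ∫ t in Ioi 0, Real.exp (-(s * t)) * wrightTime ν b c t =
      s ^ (-b) * Real.exp (-(c * s ^ ν)) := by
  have hint := integrableOn_wrightDensity hν₀ hν hb hc
  obtain ⟨h1, h2⟩ := integrableOn_exp_mul_laplace hs.le hint.aestronglyMeasurable
    (integrableOn_div_add hint hs)
  rw [integral_wrightDensity_div_add hν₀ hν hc hb hs] at h2
  have heq : EqOn (fun t => Real.exp (-(s * t)) * wrightTime ν b c t)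
      (fun t => Real.pi⁻¹ * (Real.exp (-(s * t)) *
        ∫ r in Ioi 0, Real.exp (-(t * r)) * wrightDensity ν b c r)) (Ioi 0) := fun t ht => by
    simp only
    rw [wrightTime_eq_laplace hν₀ (by linarith) hb c ht]
    ring
  refine ⟨IntegrableOn.congr_fun (h1.const_mul _) heq.symm measurableSet_Ioi, ?_⟩
  rw [setIntegral_congr_fun measurableSet_Ioi heq, integral_const_mul, h2,
    inv_mul_cancel_left₀ Real.pi_ne_zero]

theorem exists_abs_wrightTime_le {ν b c : ℝ} (hν₀ : 0 < ν) (hν : ν < 1 / 2) (hc : 0 < c)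
    (hb : b < 1) : ∃ C, ∀ t, 0 < t → |wrightTime ν b c t| ≤ C := by
  refine ⟨Real.pi⁻¹ * ∫ r in Ioi 0, |wrightDensity ν b c r|, fun t ht => ?_⟩
  rw [wrightTime_eq_laplace hν₀ (by linarith) hb c ht, abs_mul, abs_of_pos (by positivity)]
  gcongr
  rw [← Real.norm_eq_abs]
  refine norm_integral_le_of_norm_le (integrableOn_wrightDensity hν₀ hν hb hc).norm ?_
  refine (ae_restrict_mem measurableSet_Ioi).mono fun r hr => ?_
  have hr : 0 < r := hr
  rw [norm_mul, Real.norm_of_nonneg (by positivity)]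
  refine mul_le_of_le_one_left (norm_nonneg _) ?_
  rw [Real.exp_le_one_iff, neg_nonpos]
  positivity

theorem continuousOn_wrightTime {ν b : ℝ} (hν₀ : 0 < ν) (hν₁ : ν < 1) (hb : b ≤ 1) (c : ℝ) :
    ContinuousOn (wrightTime ν b c) (Ioi 0) := by
  have h1 : ∀ q : ℝ, ContinuousOn (fun t : ℝ => t ^ q) (Ioi 0) := fun q =>
    continuousOn_id.rpow_const fun r hr => Or.inl (ne_of_gt hr)
  unfold wrightTime
  exact (h1 _).mul ((continuous_wright hν₀ hν₁ hb).comp_continuousOn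
    ((h1 (-ν)).const_mul c).neg)

/-- The total mass of `t⁻¹ W(-c t ^ (-ν); -ν; 0)`; it is the limit of the Laplace transform
at `s = 0`. -/
theorem integral_wrightTime_zero {ν c : ℝ} (hν₀ : 0 < ν) (hν : ν < 1 / 2) (hc : 0 < c) :
    IntegrableOn (wrightTime ν 0 c) (Ioi 0) ∧ ∫ t in Ioi 0, wrightTime ν 0 c t = 1 := by
  have hint := integrableOn_wrightDensity (b := 0) hν₀ hν one_pos hc
  have h0 := (integrableOn_exp_mul_laplace le_rfl hint.aestronglyMeasurable
    (by simpa using integrableOn_wrightDensity_zero_div hν₀ hν hc)).1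
  have heq : EqOn (wrightTime ν 0 c)
      (fun t => Real.pi⁻¹ * (Real.exp (-(0 * t)) *
        ∫ r in Ioi 0, Real.exp (-(t * r)) * wrightDensity ν 0 c r)) (Ioi 0) := fun t ht => by
    simp only
    rw [wrightTime_eq_laplace hν₀ (by linarith) one_pos c ht]
    simp
  have hI : IntegrableOn (wrightTime ν 0 c) (Ioi 0) :=
    IntegrableOn.congr_fun (h0.const_mul _) heq.symm measurableSet_Ioi
  refine ⟨hI, ?_⟩
  have hlim1 : Tendsto (fun s => ∫ t in Ioi 0, Real.exp (-(s * t)) * wrightTime ν 0 c t)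
      (𝓝[>] 0) (𝓝 (∫ t in Ioi 0, wrightTime ν 0 c t)) := by
    refine tendsto_integral_filter_of_dominated_convergence (fun t => ‖wrightTime ν 0 c t‖) ?_ ?_
      hI.norm ?_
    · filter_upwards [self_mem_nhdsWithin] with s hs
      exact (laplace_wrightTime hν₀ hν hc one_pos hs).1.aestronglyMeasurable
    · filter_upwards [self_mem_nhdsWithin] with s hs
      have hs : 0 < s := hs
      refine (ae_restrict_mem measurableSet_Ioi).mono fun t ht => ?_
      have ht : 0 < t := ht
      rw [norm_mul, Real.norm_of_nonneg (by positivity)]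
      refine mul_le_of_le_one_left (norm_nonneg _) ?_
      rw [Real.exp_le_one_iff, neg_nonpos]
      positivity
    · refine Eventually.of_forall fun t => ?_
      have : Continuous fun s : ℝ => Real.exp (-(s * t)) * wrightTime ν 0 c t := by fun_prop
      have h := this.tendsto 0
      simp only [zero_mul, neg_zero, Real.exp_zero, one_mul] at h
      exact h.mono_left nhdsWithin_le_nhds
  have hlim2 : Tendsto (fun s => ∫ t in Ioi 0, Real.exp (-(s * t)) * wrightTime ν 0 c t)
      (𝓝[>] 0) (𝓝 1) := by
    have hc1 : ContinuousAt (fun s : ℝ => Real.exp (-(c * s ^ ν))) 0 := by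
      have : ContinuousAt (fun r : ℝ => r ^ ν) 0 :=
        Real.continuousAt_rpow_const _ _ (Or.inr hν₀.le)
      fun_prop
    have h := hc1.tendsto
    rw [Real.zero_rpow hν₀.ne', mul_zero, neg_zero, Real.exp_zero] at h
    refine (h.mono_left nhdsWithin_le_nhds).congr' ?_
    filter_upwards [self_mem_nhdsWithin] with s hs
    rw [(laplace_wrightTime hν₀ hν hc one_pos hs).2, neg_zero, Real.rpow_zero, one_mul]
  exact tendsto_nhds_unique hlim1 hlim2

/-! ### Positive functionals on polynomials over the unit interval -/

/-- The linear functional `x ^ j ↦ φ j` is nonnegative on the polynomials that are nonnegative on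
`[0, 1]`; by Hausdorff's theorem these `φ` are the moment sequences of positive measures on
`[0, 1]`. -/
def IsHausdorffPositive (φ : ℕ → ℝ) : Prop :=
  ∀ (n : ℕ) (a : ℕ → ℝ), (∀ x ∈ Icc (0 : ℝ) 1, 0 ≤ ∑ j ∈ Finset.range n, a j * x ^ j) →
    0 ≤ ∑ j ∈ Finset.range n, a j * φ j

namespace IsHausdorffPositive

theorem zero : IsHausdorffPositive fun _ => 0 := fun n a _ => by simp

theorem one : IsHausdorffPositive fun _ => 1 := fun n a h => by
  simpa using h 1 (by simp)

theorem add {φ ψ : ℕ → ℝ} (hφ : IsHausdorffPositive φ) (hψ : IsHausdorffPositive ψ) :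
    IsHausdorffPositive fun j => φ j + ψ j := fun n a h => by
  simp only [mul_add, Finset.sum_add_distrib]
  exact add_nonneg (hφ n a h) (hψ n a h)

theorem const_mul {φ : ℕ → ℝ} (hφ : IsHausdorffPositive φ) {r : ℝ} (hr : 0 ≤ r) :
    IsHausdorffPositive fun j => r * φ j := fun n a h => by
  simp only [mul_left_comm _ r, ← Finset.mul_sum]
  exact mul_nonneg hr (hφ n a h)

/-- If `p ≥ 0` on `[0, 1]`, then applying the functional of `ψ` to `y ↦ p (x y)` gives a polynomial
in `x` that is nonnegative on `[0, 1]`. -/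
theorem mul {φ ψ : ℕ → ℝ} (hφ : IsHausdorffPositive φ) (hψ : IsHausdorffPositive ψ) :
    IsHausdorffPositive fun j => φ j * ψ j := fun n a h => by
  have h1 := hφ n (fun j => a j * ψ j) fun x hx => by
    have h2 := hψ n (fun j => a j * x ^ j) fun y hy => by
      simpa only [mul_assoc, mul_pow] using
        h (x * y) ⟨mul_nonneg hx.1 hy.1, mul_le_one₀ hx.2 hy.1 hy.2⟩
    simpa only [mul_right_comm] using h2
  simpa only [mul_right_comm, mul_assoc] using h1

theorem pow {φ : ℕ → ℝ} (hφ : IsHausdorffPositive φ) (k : ℕ) :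
    IsHausdorffPositive fun j => φ j ^ k := by
  induction k with
  | zero => simpa using one
  | succ k ih => simpa only [pow_succ] using ih.mul hφ

theorem sum {φ : ℕ → ℕ → ℝ} (hφ : ∀ k, IsHausdorffPositive (φ k)) (N : ℕ) :
    IsHausdorffPositive fun j => ∑ k ∈ Finset.range N, φ k j := by
  induction N with
  | zero => simpa using zero
  | succ N ih => simpa only [Finset.sum_range_succ] using ih.add (hφ N)

theorem of_tendsto {ι : Type*} {l : Filter ι} [l.NeBot] {φ : ι → ℕ → ℝ} {ψ : ℕ → ℝ}
    (hφ : ∀ᶠ i in l, IsHausdorffPositive (φ i)) (h : ∀ j, Tendsto (fun i => φ i j) l (𝓝 (ψ j))) :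
    IsHausdorffPositive ψ := fun n a ha =>
  ge_of_tendsto (tendsto_finsetSum _ fun j _ => (h j).const_mul (a j))
    (hφ.mono fun _ hi => hi n a ha)

theorem exp {φ : ℕ → ℝ} (hφ : IsHausdorffPositive φ) :
    IsHausdorffPositive fun j => Real.exp (φ j) := by
  refine of_tendsto (l := atTop) (φ := fun N j => ∑ k ∈ Finset.range N, φ j ^ k / (k.factorial : ℝ))
    (Eventually.of_forall fun N => sum (fun k => ?_) N) fun j => ?_
  · simpa only [div_eq_inv_mul] using (hφ.pow k).const_mul (by positivity)
  · have h := NormedSpace.expSeries_div_hasSum_exp (φ j)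
    rw [← Real.exp_eq_exp_ℝ] at h
    exact h.tendsto_sum_nat

theorem setIntegral {S : Set ℝ} (hS : MeasurableSet S) {φ : ℝ → ℕ → ℝ}
    (hφ : ∀ t ∈ S, IsHausdorffPositive (φ t)) (hint : ∀ j, IntegrableOn (fun t => φ t j) S) :
    IsHausdorffPositive fun j => ∫ t in S, φ t j := fun n a h => by
  simp only [← integral_const_mul]
  rw [← integral_finsetSum _ fun j _ => (hint j).const_mul (a j)]
  exact setIntegral_nonneg hS fun t ht => hφ t ht n a h

theorem pow_of_mem {x : ℝ} (hx : x ∈ Icc (0 : ℝ) 1) : IsHausdorffPositive fun j => x ^ j :=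
  fun _ _ h => h x hx

/-- `1 / (t + j + 1)` is the `j`-th moment of `x ^ t dx` on `[0, 1]`. -/
theorem inv_add {t : ℝ} (ht : 0 < t) :
    IsHausdorffPositive fun j => (t + ((j : ℝ) + 1))⁻¹ := by
  have hcont : ∀ j : ℕ, Continuous fun x : ℝ => x ^ t * x ^ j := fun j =>
    (Real.continuous_rpow_const ht.le).mul (continuous_pow j)
  have h := setIntegral (S := Ioc (0 : ℝ) 1) measurableSet_Ioc (φ := fun x j => x ^ t * x ^ j)
    (fun x hx => (pow_of_mem (Ioc_subset_Icc_self hx)).const_mul (Real.rpow_nonneg hx.1.le t))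
    fun j => ((hcont j).integrableOn_Icc).mono_set Ioc_subset_Icc_self
  convert h using 2 with j
  have h1 : ∫ x in Ioc (0 : ℝ) 1, x ^ t * x ^ j = ∫ x in Ioc (0 : ℝ) 1, x ^ (t + j) :=
    setIntegral_congr_fun measurableSet_Ioc fun x hx => by
      have hx : 0 < x := hx.1
      rw [Real.rpow_add hx, Real.rpow_natCast]
  have h0 : 0 < t + j + 1 := by positivity
  rw [h1, ← intervalIntegral.integral_of_le zero_le_one, integral_rpow (Or.inl (by linarith)),
    Real.one_rpow, Real.zero_rpow h0.ne', sub_zero, one_div, add_assoc]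

/-- `exp (-c s ^ ν)` is a limit of functions `exp (-A) exp (∫ t ^ ν / (t + s) dt)`, because
`s ^ ν` is proportional to `∫ t ^ ν (1 / t - 1 / (t + s)) dt`. -/
theorem exp_neg_mul_rpow {ν c : ℝ} (hν₀ : 0 < ν) (hν₁ : ν < 1) (hc : 0 < c) :
    IsHausdorffPositive fun j => Real.exp (-(c * ((j : ℝ) + 1) ^ ν)) := by
  have hp : ν ∈ Ioo (0 : ℝ) 1 := ⟨hν₀, hν₁⟩
  set C := ∫ t in Ioi 0, Real.rpowIntegrand₀₁ ν t 1 with hC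
  have hCpos : 0 < C := Real.integral_rpowIntegrand₀₁_one_pos hp
  have hint1 : ∀ N : ℝ, 0 < N → IntegrableOn (fun t : ℝ => t ^ ν * t⁻¹) (Ioc 0 N) := by
    intro N hN
    have h := (intervalIntegrable_iff_integrableOn_Ioc_of_le hN.le).mp
      (intervalIntegral.intervalIntegrable_rpow' (a := 0) (b := N) (r := ν - 1) (by linarith))
    refine h.congr_fun (fun t ht => ?_) measurableSet_Ioc
    show t ^ (ν - 1) = t ^ ν * t⁻¹
    rw [Real.rpow_sub_one ht.1.ne', div_eq_mul_inv]
  have hint2 : ∀ (N : ℝ) (s : ℝ), 0 < s →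
      IntegrableOn (fun t : ℝ => t ^ ν * (t + s)⁻¹) (Ioc 0 N) := by
    intro N s hs
    refine (ContinuousOn.integrableOn_Icc ?_).mono_set Ioc_subset_Icc_self
    refine (Real.continuous_rpow_const hν₀.le).continuousOn.mul ?_
    refine (continuous_id.add continuous_const).continuousOn.inv₀ fun t ht => ?_
    have : 0 ≤ t := ht.1
    exact ne_of_gt (show 0 < t + s by linarith)
  have hpos : ∀ N : ℝ, 0 < N → IsHausdorffPositive fun j =>
      Real.exp (-(c / C * ∫ t in (0 : ℝ)..N, Real.rpowIntegrand₀₁ ν t ((j : ℝ) + 1))) := by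
    intro N hN
    have h1 : IsHausdorffPositive fun j =>
        ∫ t in Ioc 0 N, t ^ ν * (t + ((j : ℝ) + 1))⁻¹ :=
      setIntegral measurableSet_Ioc
        (fun t ht => (inv_add ht.1).const_mul (Real.rpow_nonneg ht.1.le ν))
        fun j => hint2 N _ (by positivity)
    have h2 := ((h1.const_mul (div_pos hc hCpos).le).exp).const_mul
      (Real.exp_pos (-(c / C * ∫ t in Ioc 0 N, t ^ ν * t⁻¹))).le
    convert h2 using 2 with j
    rw [← Real.exp_add, intervalIntegral.integral_of_le hN.le]
    simp only [Real.rpowIntegrand₀₁, mul_sub]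
    rw [integral_sub (hint1 N hN) (hint2 N _ (by positivity))]
    congr 1
    ring
  refine of_tendsto (l := atTop) ((eventually_gt_atTop (0 : ℝ)).mono hpos) fun j => ?_
  have hj : (0 : ℝ) ≤ (j : ℝ) + 1 := by positivity
  have hlim := intervalIntegral_tendsto_integral_Ioi 0
    (Real.integrableOn_rpowIntegrand₀₁_Ioi hp hj) tendsto_id
  rw [Real.integral_rpowIntegrand₀₁_eq_rpow_mul_const hp hj, ← hC] at hlim
  have h := (Real.continuous_exp.tendsto _).comp (hlim.const_mul (c / C)).neg
  rwa [show c / C * (((j : ℝ) + 1) ^ ν * C) = c * ((j : ℝ) + 1) ^ ν by field_simp] at h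

end IsHausdorffPositive

/-! ### Laplace transforms and positivity -/

theorem integrableOn_mul_exp_neg_mul {f h : ℝ → ℝ} (hf : ContinuousOn f (Ioi 0)) {C D : ℝ}
    (hC : ∀ t, 0 < t → |f t| ≤ C) (hh : ContinuousOn h (Icc 0 1))
    (hD : ∀ x ∈ Icc (0 : ℝ) 1, |h x| ≤ D) :
    IntegrableOn (fun t => h (Real.exp (-t)) * (Real.exp (-t) * f t)) (Ioi 0) := by
  have hmem : ∀ t ∈ Ioi (0 : ℝ), Real.exp (-t) ∈ Icc (0 : ℝ) 1 := fun t ht =>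
    ⟨(Real.exp_pos _).le, by rw [Real.exp_le_one_iff]; exact neg_nonpos.mpr (le_of_lt ht)⟩
  have hcont : ContinuousOn (fun t => h (Real.exp (-t)) * (Real.exp (-t) * f t)) (Ioi 0) :=
    (hh.comp (Continuous.continuousOn (by fun_prop)) hmem).mul
      ((Continuous.continuousOn (by fun_prop)).mul hf)
  have hE : IntegrableOn (fun t : ℝ => Real.exp (-t)) (Ioi 0) := by
    simpa using exp_neg_integrableOn_Ioi 0 one_pos
  refine (hE.mul_const (D * C)).mono' (hcont.aestronglyMeasurable measurableSet_Ioi) ?_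
  refine (ae_restrict_mem measurableSet_Ioi).mono fun t ht => ?_
  have h1 := hD _ (hmem t ht)
  have h2 := hC t ht
  rw [Real.norm_eq_abs, abs_mul, abs_mul, Real.abs_exp]
  have h3 : 0 ≤ D := (abs_nonneg _).trans h1
  calc _ ≤ D * (Real.exp (-t) * C) := by gcongr
    _ = _ := by ring

theorem integral_polynomial_mul_nonneg {f : ℝ → ℝ} (hf : ContinuousOn f (Ioi 0)) {C : ℝ}
    (hC : ∀ t, 0 < t → |f t| ≤ C)
    (hpos : IsHausdorffPositive fun j => ∫ t in Ioi 0, Real.exp (-(((j : ℝ) + 1) * t)) * f t)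
    (p : Polynomial ℝ) (hp : ∀ x ∈ Icc (0 : ℝ) 1, 0 ≤ p.eval x) :
    0 ≤ ∫ t in Ioi 0, p.eval (Real.exp (-t)) * (Real.exp (-t) * f t) := by
  simp only [Polynomial.eval_eq_sum_range] at hp ⊢
  have h := hpos _ _ hp
  convert h using 1
  have hmono : ∀ j : ℕ, IntegrableOn
      (fun t => (Real.exp (-t)) ^ j * (Real.exp (-t) * f t)) (Ioi 0) := fun j =>
    integrableOn_mul_exp_neg_mul (h := fun x => x ^ j) (D := 1) hf hC (continuous_pow j).continuousOn fun x hx => by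
      rw [abs_pow, abs_of_nonneg hx.1]
      exact pow_le_one₀ hx.1 hx.2
  simp only [Finset.sum_mul, mul_assoc]
  rw [integral_finsetSum _ fun j _ => (hmono j).const_mul _]
  refine Finset.sum_congr rfl fun j _ => ?_
  rw [integral_const_mul]
  congr 2
  funext t
  rw [← mul_assoc, ← Real.exp_nat_mul, ← Real.exp_add]
  ring_nf

theorem integral_continuous_mul_nonneg {f : ℝ → ℝ} (hf : ContinuousOn f (Ioi 0)) {C : ℝ}
    (hC : ∀ t, 0 < t → |f t| ≤ C)
    (hpos : IsHausdorffPositive fun j => ∫ t in Ioi 0, Real.exp (-(((j : ℝ) + 1) * t)) * f t)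
    {h : ℝ → ℝ} (hh : ContinuousOn h (Icc 0 1)) (hh0 : ∀ x ∈ Icc (0 : ℝ) 1, 0 ≤ h x) :
    0 ≤ ∫ t in Ioi 0, h (Real.exp (-t)) * (Real.exp (-t) * f t) := by
  have hC0 : 0 ≤ C := (abs_nonneg _).trans (hC 1 one_pos)
  obtain ⟨D, hD⟩ := isCompact_Icc.exists_bound_of_continuousOn hh
  have hintH := integrableOn_mul_exp_neg_mul hf hC hh hD
  have hmem : ∀ t ∈ Ioi (0 : ℝ), Real.exp (-t) ∈ Icc (0 : ℝ) 1 := fun t ht =>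
    ⟨(Real.exp_pos _).le, by rw [Real.exp_le_one_iff]; exact neg_nonpos.mpr (le_of_lt ht)⟩
  have hE : IntegrableOn (fun t : ℝ => Real.exp (-t)) (Ioi 0) := by
    simpa using exp_neg_integrableOn_Ioi 0 one_pos
  -- it suffices to bound the integral below by `-2 ε C` for every `ε > 0`
  have key : ∀ ε : ℝ, 0 < ε →
      -(2 * ε * C) ≤ ∫ t in Ioi 0, h (Real.exp (-t)) * (Real.exp (-t) * f t) := by
    intro ε hε
    obtain ⟨p, hp⟩ := exists_polynomial_near_of_continuousOn 0 1 h hh ε hε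
    have hq : ∀ x ∈ Icc (0 : ℝ) 1, 0 ≤ (p + Polynomial.C ε).eval x := fun x hx => by
      have h1 := (abs_lt.mp (hp x hx)).1
      have h2 := hh0 x hx
      rw [Polynomial.eval_add, Polynomial.eval_C]
      linarith
    have h1 := integral_polynomial_mul_nonneg hf hC hpos _ hq
    obtain ⟨D', hD'⟩ := isCompact_Icc.exists_bound_of_continuousOn
      (p + Polynomial.C ε).continuousOn (s := Icc (0 : ℝ) 1)
    have hintP := integrableOn_mul_exp_neg_mul hf hC (p + Polynomial.C ε).continuousOn hD'
    have h2 : (∫ t in Ioi 0, (p + Polynomial.C ε).eval (Real.exp (-t)) * (Real.exp (-t) * f t)) -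
        ∫ t in Ioi 0, h (Real.exp (-t)) * (Real.exp (-t) * f t) ≤
        ∫ t in Ioi 0, Real.exp (-t) * (2 * ε * C) := by
      rw [← integral_sub hintP hintH]
      refine setIntegral_mono_on (hintP.sub hintH) (hE.mul_const _) measurableSet_Ioi
        fun t ht => ?_
      rw [← sub_mul]
      refine (le_abs_self _).trans ?_
      rw [abs_mul, abs_mul, Real.abs_exp]
      have h3 : |(p + Polynomial.C ε).eval (Real.exp (-t)) - h (Real.exp (-t))| ≤ 2 * ε := by
        have h4 := abs_lt.mp (hp _ (hmem t ht))
        rw [Polynomial.eval_add, Polynomial.eval_C, abs_le]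
        constructor <;> linarith [h4.1, h4.2]
      calc _ ≤ 2 * ε * (Real.exp (-t) * C) := by
            gcongr
            exact hC t ht
        _ = _ := by ring
    rw [integral_mul_const, integral_exp_neg_Ioi, neg_zero, Real.exp_zero, one_mul] at h2
    linarith
  by_contra hneg
  push Not at hneg
  set J := ∫ t in Ioi 0, h (Real.exp (-t)) * (Real.exp (-t) * f t) with hJ
  have h5 := key (-J / (4 * (C + 1))) (by have := neg_pos.mpr hneg; positivity)
  have h6 : 2 * (-J / (4 * (C + 1))) * C = -J * (C / (C + 1)) / 2 := by field_simp; ring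
  have h7 : C / (C + 1) ≤ 1 := by rw [div_le_one (by positivity)]; linarith
  rw [h6] at h5
  nlinarith

/-- A bounded continuous function on `(0, ∞)` is nonnegative as soon as its Laplace transform at
the positive integers is a Hausdorff moment sequence: test against the negative part. -/
theorem nonneg_of_laplace_isHausdorffPositive {f : ℝ → ℝ} (hf : ContinuousOn f (Ioi 0)) {C : ℝ}
    (hC : ∀ t, 0 < t → |f t| ≤ C)
    (hpos : IsHausdorffPositive fun j => ∫ t in Ioi 0, Real.exp (-(((j : ℝ) + 1) * t)) * f t)
    {t₀ : ℝ} (ht₀ : 0 < t₀) : 0 ≤ f t₀ := by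
  have hC0 : 0 ≤ C := (abs_nonneg _).trans (hC 1 one_pos)
  set g : ℝ → ℝ := fun t => max (-f t) 0 with hg
  have hgcont : ContinuousOn g (Ioi 0) := ContinuousOn.sup (f := fun t => -f t) hf.neg continuousOn_const
  have hg0 : ∀ t, 0 ≤ g t := fun t => le_max_right _ _
  have hgC : ∀ t, 0 < t → g t ≤ C := fun t ht =>
    max_le ((neg_le_abs _).trans (hC t ht)) hC0
  set h : ℝ → ℝ := fun x => x * (1 - x) * g (-Real.log x) with hh
  have hhbd : ∀ x ∈ Icc (0 : ℝ) 1, |h x| ≤ C * (x * (1 - x)) := by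
    intro x hx
    have hxx : 0 ≤ x * (1 - x) := mul_nonneg hx.1 (sub_nonneg.mpr hx.2)
    rw [hh, abs_mul, abs_of_nonneg hxx, abs_of_nonneg (hg0 _), mul_comm]
    rcases eq_or_lt_of_le hx.1 with h0 | h0
    · simp [← h0]
    rcases eq_or_lt_of_le hx.2 with h1 | h1
    · simp [h1]
    · exact mul_le_mul_of_nonneg_right (hgC _ (neg_pos.mpr (Real.log_neg h0 h1))) hxx
  have hhcont : ContinuousOn h (Icc 0 1) := by
    have hend : ∀ x₁ ∈ Icc (0 : ℝ) 1, x₁ * (1 - x₁) = 0 → ContinuousWithinAt h (Icc 0 1) x₁ := by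
      intro x₁ hx₁ hz
      have hval : h x₁ = 0 := by rw [hh]; simp only; rw [hz, zero_mul]
      rw [ContinuousWithinAt, hval]
      have hlim : Tendsto (fun x : ℝ => C * (x * (1 - x))) (𝓝[Icc 0 1] x₁) (𝓝 0) := by
        have hc : Continuous fun x : ℝ => C * (x * (1 - x)) := by fun_prop
        have h1 := hc.tendsto x₁
        rw [hz, mul_zero] at h1
        exact h1.mono_left nhdsWithin_le_nhds
      refine squeeze_zero_norm' ?_ hlim
      filter_upwards [self_mem_nhdsWithin] with x hx using hhbd x hx
    intro x hx
    rcases eq_or_lt_of_le hx.1 with h0 | h0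
    · exact hend x hx (by rw [← h0, zero_mul])
    rcases eq_or_lt_of_le hx.2 with h1 | h1
    · exact hend x hx (by rw [h1, sub_self, mul_zero])
    · have hlog : 0 < -Real.log x := neg_pos.mpr (Real.log_neg h0 h1)
      have hgc : ContinuousAt g (-Real.log x) := hgcont.continuousAt (Ioi_mem_nhds hlog)
      have hlc : ContinuousAt (fun x => -Real.log x) x := (Real.continuousAt_log h0.ne').neg
      have hcomp : ContinuousAt (fun x => g (-Real.log x)) x :=
        ContinuousAt.comp (f := fun x => -Real.log x) hgc hlc
      exact ((continuousAt_id.mul (continuousAt_const.sub continuousAt_id)).mul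
        hcomp).continuousWithinAt
  have hhnn : ∀ x ∈ Icc (0 : ℝ) 1, 0 ≤ h x := fun x hx =>
    mul_nonneg (mul_nonneg hx.1 (sub_nonneg.mpr hx.2)) (hg0 _)
  have hint := integral_continuous_mul_nonneg hf hC hpos hhcont hhnn
  set G : ℝ → ℝ := fun t => Real.exp (-t) * (1 - Real.exp (-t)) * Real.exp (-t) * (g t) ^ 2 with hG
  have hprod : ∀ t, g t * f t = -(g t) ^ 2 := by
    intro t
    rcases le_total (-f t) 0 with h1 | h1
    · simp [hg, max_eq_right h1]
    · simp only [hg, max_eq_left h1]; ring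
  have hGeq : ∀ t, h (Real.exp (-t)) * (Real.exp (-t) * f t) = -G t := by
    intro t
    simp only [hh, hG, Real.log_exp, neg_neg]
    linear_combination Real.exp (-t) * (1 - Real.exp (-t)) * Real.exp (-t) * hprod t
  have hGnn : ∀ t ∈ Ioi (0 : ℝ), 0 ≤ G t := by
    intro t ht
    have : Real.exp (-t) ≤ 1 := by
      rw [Real.exp_le_one_iff]; exact neg_nonpos.mpr (le_of_lt ht)
    have := sub_nonneg.mpr this
    simp only [hG]
    positivity
  obtain ⟨D, hD⟩ := isCompact_Icc.exists_bound_of_continuousOn hhcont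
  have hGint := integrableOn_mul_exp_neg_mul hf hC hhcont hD
  simp only [hGeq] at hint hGint
  rw [integral_neg] at hint
  have hGint' : IntegrableOn G (Ioi 0) := by simpa using hGint.neg
  have hzero : ∫ t in Ioi 0, G t = 0 :=
    le_antisymm (by linarith) (setIntegral_nonneg measurableSet_Ioi hGnn)
  have hae := (integral_eq_zero_iff_of_nonneg_ae
    ((ae_restrict_mem measurableSet_Ioi).mono hGnn) hGint').mp hzero
  have hGcont : ContinuousOn G (Ioi 0) :=
    (Continuous.continuousOn (by fun_prop)).mul (hgcont.pow 2)
  have hEq := Measure.eqOn_open_of_ae_eq hae isOpen_Ioi hGcont continuousOn_const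
  have h0 := hEq (mem_Ioi.mpr ht₀)
  by_contra hneg
  push Not at hneg
  have hg1 : 0 < g t₀ := lt_max_of_lt_left (neg_pos.mpr hneg)
  have he : Real.exp (-t₀) < 1 := by rw [Real.exp_lt_one_iff]; linarith
  have he' := sub_pos.mpr he
  have : 0 < G t₀ := by simp only [hG]; positivity
  exact this.ne' h0

/-! ### Sign and limits of the Wright and Mainardi functions -/

theorem wrightTime_zero_nonneg {ν c : ℝ} (hν₀ : 0 < ν) (hν : ν < 1 / 2) (hc : 0 < c)
    {t : ℝ} (ht : 0 < t) : 0 ≤ wrightTime ν 0 c t := by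
  obtain ⟨C, hC⟩ := exists_abs_wrightTime_le hν₀ hν hc one_pos
  refine nonneg_of_laplace_isHausdorffPositive
    (continuousOn_wrightTime hν₀ (by linarith) zero_le_one c) hC ?_ ht
  have h := IsHausdorffPositive.exp_neg_mul_rpow hν₀ (by linarith) hc
  convert h using 2 with j
  rw [(laplace_wrightTime hν₀ hν hc one_pos (by positivity)).2, neg_zero, Real.rpow_zero, one_mul]

theorem wrightTime_zero_eq {ν : ℝ} (hν₀ : 0 < ν) (hν₁ : ν < 1) (c t : ℝ) :
    wrightTime ν 0 c t = t ^ (-1 : ℝ) * (ν * (c * t ^ (-ν))) * mainardi ν (c * t ^ (-ν)) := by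
  rw [wrightTime, wright_neg_zero_eq hν₀ hν₁, mainardi, zero_sub]
  ring

theorem mainardi_nonneg {ν : ℝ} (hν₀ : 0 < ν) (hν : ν < 1 / 2) {x : ℝ} (hx : 0 ≤ x) :
    0 ≤ mainardi ν x := by
  rcases hx.eq_or_lt with rfl | hx
  · rw [mainardi, neg_zero, wright_zero]
    have := Real.Gamma_pos_of_pos (show 0 < 1 - ν by linarith)
    positivity
  · have h := wrightTime_zero_nonneg hν₀ hν hx one_pos
    rw [wrightTime_zero_eq hν₀ (by linarith), Real.one_rpow, Real.one_rpow, mul_one,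
      one_mul] at h
    exact nonneg_of_mul_nonneg_right h (by positivity)

theorem mainardi_zero_pos {ν : ℝ} (hν₁ : ν < 1) : 0 < mainardi ν 0 := by
  rw [mainardi, neg_zero, wright_zero]
  have := Real.Gamma_pos_of_pos (show 0 < 1 - ν by linarith)
  positivity

theorem continuous_mainardi {ν : ℝ} (hν₀ : 0 < ν) (hν₁ : ν < 1) : Continuous (mainardi ν) :=
  (continuous_wright hν₀ hν₁ (by linarith)).comp continuous_neg

theorem mainardi_le {ν : ℝ} (hν₀ : 0 < ν) (hν : ν < 1 / 2) {x : ℝ} (hx : 0 < x) :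
    mainardi ν x ≤ Real.pi⁻¹ * Real.Gamma ν := by
  have h1 : mainardi ν x = wrightTime ν (1 - ν) x 1 := by
    rw [mainardi, wrightTime, Real.one_rpow, Real.one_rpow, one_mul, mul_one]
  have hG := Real.integral_rpow_mul_exp_neg_mul_Ioi hν₀ one_pos
  have hGi : IntegrableOn (fun t : ℝ => t ^ (ν - 1) * Real.exp (-(1 * t))) (Ioi 0) := by
    refine Integrable.of_integral_ne_zero ?_
    rw [hG]
    have := Real.Gamma_pos_of_pos hν₀
    positivity
  rw [h1, wrightTime_eq_laplace hν₀ (by linarith) (by linarith) x one_pos]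
  gcongr
  rw [div_one, Real.one_rpow, one_mul] at hG
  rw [← hG]
  refine (le_abs_self _).trans ?_
  rw [← Real.norm_eq_abs]
  refine norm_integral_le_of_norm_le hGi ?_
  refine (ae_restrict_mem measurableSet_Ioi).mono fun r hr => ?_
  have hr : 0 < r := hr
  rw [norm_mul, Real.norm_of_nonneg (by positivity), mul_comm]
  have h2 := abs_wrightDensity_le ν (1 - ν) x hr
  have h3 : Real.exp (-(x * Real.cos (Real.pi * ν)) * r ^ ν) ≤ 1 := by
    have := cos_pi_mul_pos hν₀ hν
    rw [Real.exp_le_one_iff, neg_mul, neg_nonpos]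
    positivity
  rw [Real.norm_eq_abs, ← neg_sub 1 ν]
  gcongr
  exact h2.trans (mul_le_of_le_one_right (by positivity) h3)

theorem hasDerivAt_wright_neg {ν : ℝ} (hν₀ : 0 < ν) (hν₁ : ν < 1) (x : ℝ) :
    HasDerivAt (fun x => wright (-x) (-ν) 1) (-mainardi ν x) x := by
  have h := HasDerivAt.comp x (hasDerivAt_wright hν₀ hν₁ le_rfl (-x)) (hasDerivAt_neg x)
  exact h.congr_deriv (by rw [mainardi, mul_neg_one])

theorem hasDerivAt_mainardi {ν : ℝ} (hν₀ : 0 < ν) (hν₁ : ν < 1) (x : ℝ) :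
    HasDerivAt (mainardi ν) (-wright (-x) (-ν) (1 - 2 * ν)) x := by
  have h := HasDerivAt.comp x (hasDerivAt_wright (b := 1 - ν) hν₀ hν₁ (by linarith) (-x))
    (hasDerivAt_neg x)
  rw [show 1 - ν - ν = 1 - 2 * ν by ring] at h
  exact h.congr_deriv (by rw [mul_neg_one])

/-- The density `t⁻¹ W(-c t ^ (-ν); -ν; 0)` is the time derivative of the self-similar profile. -/
theorem hasDerivAt_wright_time {ν : ℝ} (hν₀ : 0 < ν) (hν₁ : ν < 1) (c : ℝ) {t : ℝ} (ht : 0 < t) :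
    HasDerivAt (fun t => wright (-(c * t ^ (-ν))) (-ν) 1) (wrightTime ν 0 c t) t := by
  have h1 : HasDerivAt (fun t : ℝ => c * t ^ (-ν)) (c * (-ν * t ^ (-ν - 1))) t :=
    (Real.hasDerivAt_rpow_const (Or.inl ht.ne')).const_mul c
  have h2 := HasDerivAt.comp t (hasDerivAt_wright_neg hν₀ hν₁ (c * t ^ (-ν))) h1
  refine h2.congr_deriv ?_
  rw [wrightTime_zero_eq hν₀ hν₁, sub_eq_add_neg, Real.rpow_add ht]
  ring

theorem tendsto_wright_time_atTop {ν : ℝ} (hν₀ : 0 < ν) (hν₁ : ν < 1) (c : ℝ) :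
    Tendsto (fun t : ℝ => wright (-(c * t ^ (-ν))) (-ν) 1) atTop (𝓝 1) := by
  have h1 : Tendsto (fun t : ℝ => -(c * t ^ (-ν))) atTop (𝓝 0) := by
    simpa using ((tendsto_rpow_neg_atTop hν₀).const_mul c).neg
  have h2 := ((continuous_wright hν₀ hν₁ (b := 1) le_rfl).tendsto 0).comp h1
  rwa [wright_zero, Real.Gamma_one, div_one] at h2

theorem wright_time_eq_integral {ν c : ℝ} (hν₀ : 0 < ν) (hν : ν < 1 / 2) (hc : 0 < c)
    {t : ℝ} (ht : 0 < t) :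
    wright (-(c * t ^ (-ν))) (-ν) 1 = ∫ τ in Ioc 0 t, wrightTime ν 0 c τ := by
  obtain ⟨hI, h1⟩ := integral_wrightTime_zero hν₀ hν hc
  have h2 := integral_Ioi_of_hasDerivAt_of_tendsto'
    (fun τ hτ => hasDerivAt_wright_time hν₀ (by linarith) c (lt_of_lt_of_le ht hτ))
    (hI.mono_set (Ioi_subset_Ioi ht.le)) (tendsto_wright_time_atTop hν₀ (by linarith) c)
  have h3 := setIntegral_union (μ := volume) (f := wrightTime ν 0 c)
    (Ioc_disjoint_Ioi (le_refl t) : Disjoint (Ioc 0 t) (Ioi t)) measurableSet_Ioi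
    (hI.mono_set Ioc_subset_Ioi_self) (hI.mono_set (Ioi_subset_Ioi ht.le))
  rw [Ioc_union_Ioi_eq_Ioi ht.le, h1, h2] at h3
  linarith

theorem tendsto_wright_time_zero {ν c : ℝ} (hν₀ : 0 < ν) (hν : ν < 1 / 2) (hc : 0 < c) :
    Tendsto (fun t : ℝ => wright (-(c * t ^ (-ν))) (-ν) 1) (𝓝[>] 0) (𝓝 0) := by
  obtain ⟨C, hC⟩ := exists_abs_wrightTime_le hν₀ hν hc one_pos
  have hlim : Tendsto (fun t : ℝ => C * t) (𝓝[>] 0) (𝓝 0) := by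
    have h : Continuous fun t : ℝ => C * t := by fun_prop
    have h0 := h.tendsto 0
    rw [mul_zero] at h0
    exact h0.mono_left nhdsWithin_le_nhds
  refine squeeze_zero_norm' ?_ hlim
  filter_upwards [self_mem_nhdsWithin] with t ht
  have ht : 0 < t := ht
  rw [wright_time_eq_integral hν₀ hν hc ht]
  refine (norm_setIntegral_le_of_norm_le_const (C := C) (by simp) fun τ hτ =>
    hC τ hτ.1).trans (le_of_eq ?_)
  simp [measureReal_def, ht.le]

theorem tendsto_wright_neg_atTop {ν : ℝ} (hν₀ : 0 < ν) (hν : ν < 1 / 2) :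
    Tendsto (fun x : ℝ => wright (-x) (-ν) 1) atTop (𝓝 0) := by
  have h1 : Tendsto (fun x : ℝ => x ^ (-(1 / ν))) atTop (𝓝[>] 0) := by
    refine tendsto_nhdsWithin_iff.mpr ⟨tendsto_rpow_neg_atTop (by positivity), ?_⟩
    filter_upwards [eventually_gt_atTop 0] with x hx using Real.rpow_pos_of_pos hx _
  refine ((tendsto_wright_time_zero hν₀ hν one_pos).comp h1).congr' ?_
  filter_upwards [eventually_gt_atTop 0] with x hx
  rw [Function.comp_apply, ← Real.rpow_mul hx.le,
    show -(1 / ν) * -ν = 1 by field_simp, Real.rpow_one, one_mul]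

theorem antitoneOn_wright_neg {ν : ℝ} (hν₀ : 0 < ν) (hν : ν < 1 / 2) :
    AntitoneOn (fun x => wright (-x) (-ν) 1) (Ici 0) := by
  have hd := hasDerivAt_wright_neg hν₀ (show ν < 1 by linarith)
  refine antitoneOn_of_deriv_nonpos (convex_Ici 0)
    (fun x _ => (hd x).continuousAt.continuousWithinAt)
    (fun x _ => (hd x).differentiableAt.differentiableWithinAt) fun x hx => ?_
  rw [interior_Ici] at hx
  rw [(hd x).deriv, neg_nonpos]
  exact mainardi_nonneg hν₀ hν (le_of_lt hx)

theorem wright_neg_nonneg {ν : ℝ} (hν₀ : 0 < ν) (hν : ν < 1 / 2) {x : ℝ} (hx : 0 ≤ x) :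
    0 ≤ wright (-x) (-ν) 1 := by
  refine le_of_tendsto (tendsto_wright_neg_atTop hν₀ hν) ?_
  filter_upwards [eventually_ge_atTop x] with y hy
  exact antitoneOn_wright_neg hν₀ hν hx (hx.trans hy) hy

theorem wright_zero_one (a : ℝ) : wright 0 a 1 = 1 := by
  rw [wright_zero, Real.Gamma_one, div_one]

/-- A zero would force the nonincreasing function `W(-x)` to vanish on a half-line, hence
everywhere by analyticity. -/
theorem wright_neg_pos {ν : ℝ} (hν₀ : 0 < ν) (hν : ν < 1 / 2) {x : ℝ} (hx : 0 ≤ x) :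
    0 < wright (-x) (-ν) 1 := by
  refine (wright_neg_nonneg hν₀ hν hx).lt_of_ne fun h0 => ?_
  have hev : (fun z => wright z (-ν) 1) =ᶠ[𝓝 (-(x + 1))] 0 := by
    filter_upwards [Iio_mem_nhds (show -(x + 1) < -x by linarith)] with z hz
    have hz : z < -x := hz
    have h1 := antitoneOn_wright_neg hν₀ hν hx (mem_Ici.mpr (by linarith : 0 ≤ -z))
      (by linarith : x ≤ -z)
    have h2 := wright_neg_nonneg hν₀ hν (by linarith : 0 ≤ -z)
    simp only [neg_neg] at h1 h2
    rw [← h0] at h1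
    exact le_antisymm h1 h2
  have h := (analyticOnNhd_wright hν₀ (by linarith) (b := 1)
    le_rfl).eqOn_zero_of_preconnected_of_eventuallyEq_zero isPreconnected_univ (mem_univ _) hev
    (mem_univ 0)
  simp [wright_zero_one] at h

theorem wright_neg_lt_one {ν : ℝ} (hν₀ : 0 < ν) (hν : ν < 1 / 2) {x : ℝ} (hx : 0 < x) :
    wright (-x) (-ν) 1 < 1 := by
  have hle : ∀ y : ℝ, 0 ≤ y → wright (-y) (-ν) 1 ≤ 1 := fun y hy => by
    have h := antitoneOn_wright_neg hν₀ hν (mem_Ici.mpr le_rfl) hy hy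
    simpa [wright_zero_one] using h
  refine (hle x hx.le).lt_of_ne fun h1 => ?_
  have hev : (fun z => wright z (-ν) 1) =ᶠ[𝓝 (-(x / 2))] fun _ => 1 := by
    filter_upwards [Ioo_mem_nhds (show -x < -(x / 2) by linarith)
      (show -(x / 2) < 0 by linarith)] with z hz
    have h2 := antitoneOn_wright_neg hν₀ hν (mem_Ici.mpr (by linarith [hz.2] : 0 ≤ -z)) hx.le
      (by linarith [hz.1] : -z ≤ x)
    have h3 := hle (-z) (by linarith [hz.2])
    simp only [neg_neg] at h2 h3
    rw [h1] at h2
    exact le_antisymm h3 h2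
  have h := (analyticOnNhd_wright hν₀ (by linarith) (b := 1) le_rfl).eq_of_eventuallyEq
    analyticOnNhd_const hev
  have hlim := tendsto_wright_neg_atTop hν₀ hν
  have h4 : (fun x : ℝ => wright (-x) (-ν) 1) = fun _ => 1 := by
    funext y
    exact congrFun h (-y)
  rw [h4] at hlim
  exact one_ne_zero (tendsto_nhds_unique tendsto_const_nhds hlim)

/-! ### Fractional integration of the self-similar density -/

/-- Uniqueness of Laplace transforms: the zero sequence is a moment sequence, so both `f` and `-f`
are nonnegative. -/
theorem eq_zero_of_laplace_eq_zero {f : ℝ → ℝ} (hf : ContinuousOn f (Ioi 0)) {C : ℝ}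
    (hC : ∀ t, 0 < t → |f t| ≤ C)
    (h : ∀ s, 1 ≤ s → ∫ t in Ioi 0, Real.exp (-(s * t)) * f t = 0) {t : ℝ} (ht : 0 < t) :
    f t = 0 := by
  have h0 : ∀ j : ℕ, ∫ t in Ioi 0, Real.exp (-(((j : ℝ) + 1) * t)) * f t = 0 := fun j =>
    h _ (by simp)
  refine le_antisymm ?_ ?_
  · refine neg_nonneg.mp (nonneg_of_laplace_isHausdorffPositive (f := fun t => -f t) hf.neg
      (C := C) (fun t ht => by rw [abs_neg]; exact hC t ht) ?_ ht)
    simp only [mul_neg, integral_neg, h0, neg_zero]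
    exact IsHausdorffPositive.zero
  · refine nonneg_of_laplace_isHausdorffPositive hf hC ?_ ht
    simp only [h0]
    exact IsHausdorffPositive.zero

/-- The Riemann–Liouville integral of order `β`, without the factor `1 / Γ(β)`. -/
noncomputable def fractionalIntegral (β : ℝ) (f : ℝ → ℝ) (t : ℝ) : ℝ :=
  ∫ τ in (0 : ℝ)..t, f τ * (t - τ) ^ (β - 1)

theorem intervalIntegrable_sub_rpow {β : ℝ} (hβ : 0 < β) (t : ℝ) :
    IntervalIntegrable (fun τ => (t - τ) ^ (β - 1)) volume 0 t := by
  have h := (intervalIntegral.intervalIntegrable_rpow' (a := t) (b := 0) (r := β - 1)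
    (by linarith)).comp_sub_left t
  simpa using h

theorem integral_sub_rpow {β : ℝ} (hβ : 0 < β) (t : ℝ) :
    ∫ τ in (0 : ℝ)..t, (t - τ) ^ (β - 1) = t ^ β / β := by
  have h := intervalIntegral.integral_comp_sub_left (a := 0) (b := t)
    (fun τ : ℝ => τ ^ (β - 1)) t
  rw [h, sub_self, sub_zero, integral_rpow (Or.inl (by linarith)), sub_add_cancel,
    Real.zero_rpow hβ.ne', sub_zero]

theorem abs_fractionalIntegral_le {β : ℝ} (hβ : 0 < β) {f : ℝ → ℝ} {C : ℝ}
    (hC : ∀ t, 0 < t → |f t| ≤ C) {t : ℝ} (ht : 0 < t) :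
    |fractionalIntegral β f t| ≤ C * (t ^ β / β) := by
  rw [fractionalIntegral, ← integral_sub_rpow hβ t, ← intervalIntegral.integral_const_mul,
    ← Real.norm_eq_abs]
  refine intervalIntegral.norm_integral_le_of_norm_le ht.le
    (Eventually.of_forall fun τ hτ => ?_) ((intervalIntegrable_sub_rpow hβ t).const_mul C)
  have h1 : 0 ≤ (t - τ) ^ (β - 1) := Real.rpow_nonneg (sub_nonneg.mpr hτ.2) _
  rw [norm_mul, Real.norm_eq_abs, Real.norm_of_nonneg h1]
  exact mul_le_mul_of_nonneg_right (hC τ hτ.1) h1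

theorem fractionalIntegral_eq {β : ℝ} (f : ℝ → ℝ) {t : ℝ} (ht : 0 < t) :
    fractionalIntegral β f t =
      t ^ β * ∫ v in (0 : ℝ)..1, f (t * v) * (1 - v) ^ (β - 1) := by
  have h := intervalIntegral.integral_comp_mul_left (a := 0) (b := 1)
    (fun τ => f τ * (t - τ) ^ (β - 1)) ht.ne'
  rw [mul_zero, mul_one, smul_eq_mul] at h
  rw [fractionalIntegral, ← mul_inv_cancel_left₀ ht.ne'
    (∫ τ in (0 : ℝ)..t, f τ * (t - τ) ^ (β - 1)), ← h, ← intervalIntegral.integral_const_mul,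
    ← intervalIntegral.integral_const_mul]
  refine intervalIntegral.integral_congr fun v hv => ?_
  rw [uIcc_of_le zero_le_one] at hv
  rw [show t - t * v = t * (1 - v) by ring, Real.mul_rpow ht.le (sub_nonneg.mpr hv.2),
    Real.rpow_sub_one ht.ne']
  field_simp

theorem continuousOn_fractionalIntegral {β : ℝ} (hβ : 0 < β) {f : ℝ → ℝ}
    (hf : ContinuousOn f (Ioi 0)) {C : ℝ} (hC : ∀ t, 0 < t → |f t| ≤ C) :
    ContinuousOn (fractionalIntegral β f) (Ioi 0) := by
  have hEq : EqOn (fractionalIntegral β f)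
      (fun t => t ^ β * ∫ v in (0 : ℝ)..1, f (t * v) * (1 - v) ^ (β - 1)) (Ioi 0) :=
    fun t ht => fractionalIntegral_eq f ht
  refine ContinuousOn.congr ?_ hEq
  refine (Real.continuous_rpow_const hβ.le).continuousOn.mul fun t ht => ?_
  have hmul : ∀ v : ℝ, 0 < v → ContinuousOn (fun t => f (t * v)) (Ioi 0) := fun v hv =>
    hf.comp (Continuous.continuousOn (by fun_prop)) fun t ht => mul_pos ht hv
  refine intervalIntegral.continuousWithinAt_of_dominated_interval
    (bound := fun v => C * (1 - v) ^ (β - 1)) ?_ ?_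
    ((intervalIntegrable_sub_rpow hβ 1).const_mul C) ?_
  · filter_upwards [self_mem_nhdsWithin] with t ht
    rw [uIoc_of_le zero_le_one]
    refine AEStronglyMeasurable.mul ?_ ?_
    · refine ContinuousOn.aestronglyMeasurable ?_ measurableSet_Ioc
      exact hf.comp (Continuous.continuousOn (by fun_prop)) fun v hv => mul_pos ht hv.1
    · have h := (intervalIntegrable_sub_rpow hβ 1).aestronglyMeasurable
      exact h
  · filter_upwards [self_mem_nhdsWithin] with t ht
    refine Eventually.of_forall fun v hv => ?_
    rw [uIoc_of_le zero_le_one] at hv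
    have h1 : 0 ≤ (1 - v) ^ (β - 1) := Real.rpow_nonneg (sub_nonneg.mpr hv.2) _
    rw [norm_mul, Real.norm_eq_abs, Real.norm_of_nonneg h1]
    exact mul_le_mul_of_nonneg_right (hC _ (mul_pos ht hv.1)) h1
  · refine Eventually.of_forall fun v hv => ?_
    rw [uIoc_of_le zero_le_one] at hv
    exact (hmul v hv.1 t ht).mul continuousWithinAt_const

theorem laplace_fractionalIntegral {β : ℝ} (hβ : 0 < β) {f : ℝ → ℝ} {s : ℝ} (hs : 0 < s)
    (hf : IntegrableOn (fun t => Real.exp (-(s * t)) * f t) (Ioi 0)) :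
    IntegrableOn (fun t => Real.exp (-(s * t)) * fractionalIntegral β f t) (Ioi 0) ∧
    ∫ t in Ioi 0, Real.exp (-(s * t)) * fractionalIntegral β f t =
      (∫ t in Ioi 0, Real.exp (-(s * t)) * f t) * ((1 / s) ^ β * Real.Gamma β) := by
  have hgint := Real.integral_rpow_mul_exp_neg_mul_Ioi hβ hs
  have hg : IntegrableOn (fun t : ℝ => t ^ (β - 1) * Real.exp (-(s * t))) (Ioi 0) := by
    refine Integrable.of_integral_ne_zero ?_
    rw [hgint]
    have := Real.Gamma_pos_of_pos hβ
    positivity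
  have heq : ∀ t : ℝ, (∫ τ in (0 : ℝ)..t, (ContinuousLinearMap.mul ℝ ℝ)
      (Real.exp (-(s * τ)) * f τ) ((t - τ) ^ (β - 1) * Real.exp (-(s * (t - τ))))) =
      Real.exp (-(s * t)) * fractionalIntegral β f t := by
    intro t
    rw [fractionalIntegral, ← intervalIntegral.integral_const_mul]
    refine intervalIntegral.integral_congr fun τ _ => ?_
    simp only [ContinuousLinearMap.mul_apply']
    rw [show -(s * t) = -(s * τ) + -(s * (t - τ)) by ring, Real.exp_add]
    ring
  constructor
  · have h := integrable_posConvolution hf hg (ContinuousLinearMap.mul ℝ ℝ)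
    unfold posConvolution at h
    rw [integrable_indicator_iff measurableSet_Ioi] at h
    simpa only [heq] using h
  · have h := integral_posConvolution hf hg (ContinuousLinearMap.mul ℝ ℝ)
    simp only [heq] at h
    rwa [ContinuousLinearMap.mul_apply', hgint] at h

/-- Both sides have the Laplace transform `Γ(β) s ^ (-β) exp (-c s ^ ν)`. -/
theorem fractionalIntegral_wrightTime {ν β c : ℝ} (hν₀ : 0 < ν) (hν : ν < 1 / 2) (hc : 0 < c)
    (hβ₀ : 0 < β) (hβ₁ : β < 1) {t : ℝ} (ht : 0 < t) :
    fractionalIntegral β (wrightTime ν 0 c) t = Real.Gamma β * wrightTime ν β c t := by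
  obtain ⟨C₀, hC₀⟩ := exists_abs_wrightTime_le hν₀ hν hc one_pos
  obtain ⟨C₁, hC₁⟩ := exists_abs_wrightTime_le hν₀ hν hc hβ₁
  have hcont₀ := continuousOn_wrightTime hν₀ (show ν < 1 by linarith) zero_le_one c
  have hcont₁ := continuousOn_wrightTime hν₀ (show ν < 1 by linarith) hβ₁.le c
  have hC₀pos : 0 ≤ C₀ := (abs_nonneg _).trans (hC₀ 1 one_pos)
  have hG := Real.Gamma_pos_of_pos hβ₀
  set D : ℝ → ℝ := fun t => Real.exp (-t) *
    (fractionalIntegral β (wrightTime ν 0 c) t - Real.Gamma β * wrightTime ν β c t) with hD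
  have hDcont : ContinuousOn D (Ioi 0) :=
    (Continuous.continuousOn (by fun_prop)).mul
      ((continuousOn_fractionalIntegral hβ₀ hcont₀ hC₀).sub (hcont₁.const_mul _))
  have hDbd : ∀ t, 0 < t → |D t| ≤ C₀ / β + Real.Gamma β * C₁ := by
    intro t ht
    have h1 := abs_fractionalIntegral_le hβ₀ hC₀ ht
    have h2 := hC₁ t ht
    have h3 : t ^ β ≤ Real.exp t := by
      refine le_trans ?_ (Real.add_one_le_exp t)
      rcases le_total t 1 with h | h
      · have := Real.rpow_le_one ht.le h hβ₀.le
        linarith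
      · have := Real.rpow_le_rpow_of_exponent_le h hβ₁.le
        rw [Real.rpow_one] at this
        linarith
    have h4 : Real.exp (-t) ≤ 1 := by rw [Real.exp_le_one_iff]; linarith
    have h5 : Real.exp (-t) * Real.exp t = 1 := by rw [← Real.exp_add]; simp
    simp only [hD]
    rw [abs_mul, Real.abs_exp]
    calc Real.exp (-t) * |fractionalIntegral β (wrightTime ν 0 c) t -
          Real.Gamma β * wrightTime ν β c t|
        ≤ Real.exp (-t) * (C₀ * (Real.exp t / β) + Real.Gamma β * C₁) := by
          gcongr
          refine (abs_sub _ _).trans (add_le_add (h1.trans ?_) ?_)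
          · gcongr
          · rw [abs_mul, abs_of_pos hG]
            gcongr
      _ = C₀ / β * (Real.exp (-t) * Real.exp t) + Real.exp (-t) * (Real.Gamma β * C₁) := by ring
      _ ≤ C₀ / β * 1 + 1 * (Real.Gamma β * C₁) := by
          have : 0 ≤ C₁ := (abs_nonneg _).trans h2
          rw [h5]
          gcongr
      _ = _ := by ring
  have hDlap : ∀ s, 1 ≤ s → ∫ t in Ioi 0, Real.exp (-(s * t)) * D t = 0 := by
    intro s hs
    have hs1 : 0 < s + 1 := by linarith
    obtain ⟨i0, e0⟩ := laplace_wrightTime hν₀ hν hc one_pos hs1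
    obtain ⟨i1, e1⟩ := laplace_wrightTime hν₀ hν hc hβ₁ hs1
    obtain ⟨i2, e2⟩ := laplace_fractionalIntegral hβ₀ hs1 i0
    have heq : ∀ t, Real.exp (-(s * t)) * D t =
        Real.exp (-((s + 1) * t)) * fractionalIntegral β (wrightTime ν 0 c) t -
        Real.Gamma β * (Real.exp (-((s + 1) * t)) * wrightTime ν β c t) := by
      intro t
      simp only [hD]
      rw [show -((s + 1) * t) = -(s * t) + -t by ring, Real.exp_add]
      ring
    simp only [heq]
    rw [integral_sub i2 (i1.const_mul _), integral_const_mul, e1, e2, e0, one_div,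
      Real.inv_rpow hs1.le, ← Real.rpow_neg hs1.le, neg_zero, Real.rpow_zero]
    ring
  have h := eq_zero_of_laplace_eq_zero hDcont hDbd hDlap ht
  simp only [hD] at h
  rcases mul_eq_zero.mp h with h | h
  · exact absurd h (Real.exp_pos _).ne'
  · linarith

/-! ### Caputo derivatives -/

theorem fractionalIntegral_rpow {ν β : ℝ} (hν : 0 < ν) (hβ : 0 < β) {t : ℝ} (ht : 0 < t) :
    fractionalIntegral β (fun τ => τ ^ (ν - 1)) t =
      t ^ (ν + β - 1) * (Real.Gamma ν * Real.Gamma β / Real.Gamma (ν + β)) := by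
  have h1 := Complex.betaIntegral_scaled (ν : ℂ) (β : ℂ) ht
  rw [Complex.betaIntegral_eq_Gamma_mul_div _ _ (by simpa using hν) (by simpa using hβ)] at h1
  rw [← Complex.ofReal_inj, fractionalIntegral, ← intervalIntegral.integral_ofReal]
  have h2 : ∫ τ in (0 : ℝ)..t, ((τ ^ (ν - 1) * (t - τ) ^ (β - 1) : ℝ) : ℂ) =
      ∫ τ in (0 : ℝ)..t, (τ : ℂ) ^ ((ν : ℂ) - 1) * ((t : ℂ) - τ) ^ ((β : ℂ) - 1) := by
    refine intervalIntegral.integral_congr fun τ hτ => ?_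
    rw [uIcc_of_le ht.le] at hτ
    push_cast
    rw [Complex.ofReal_cpow hτ.1, Complex.ofReal_cpow (sub_nonneg.mpr hτ.2)]
    push_cast
    rfl
  rw [h2, h1]
  push_cast
  rw [Complex.ofReal_cpow ht.le, ← Complex.Gamma_ofReal, ← Complex.Gamma_ofReal,
    ← Complex.Gamma_ofReal]
  push_cast
  rfl

theorem HasCaputoDeriv.const_add_mul {α v t : ℝ} {f : ℝ → ℝ} (h : HasCaputoDeriv α f v t)
    (A B : ℝ) : HasCaputoDeriv α (fun τ => A + B * f τ) (B * v) t := by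
  have hd : ∀ τ, (t - τ) ^ (-α) * deriv (fun τ => A + B * f τ) τ =
      B * ((t - τ) ^ (-α) * deriv f τ) := by
    intro τ
    rw [deriv_const_add, deriv_const_mul_field]
    ring
  refine ⟨continuousOn_const.add (continuousOn_const.mul h.continuousOn),
    fun τ hτ => ((h.differentiableAt τ hτ).const_mul B).const_add A, ?_, ?_⟩
  · simp only [hd]
    exact h.integrable.const_mul B
  · rw [← h.eq, caputoDeriv, caputoDeriv]
    simp only [hd]
    rw [intervalIntegral.integral_const_mul]
    ring

/-- Criterion for the Caputo derivative of a function with known derivative on `(0, t]`. -/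
theorem hasCaputoDeriv_of_hasDerivAt {α t : ℝ} (ht : 0 < t) {f f' : ℝ → ℝ}
    (hc : ContinuousWithinAt f (Ici 0) 0) (hd : ∀ τ, 0 < τ → HasDerivAt f (f' τ) τ)
    (hint : IntervalIntegrable (fun τ => f' τ * (t - τ) ^ ((1 - α) - 1)) volume 0 t) :
    HasCaputoDeriv α f (1 / Real.Gamma (1 - α) * fractionalIntegral (1 - α) f' t) t := by
  have heq : EqOn (fun τ => f' τ * (t - τ) ^ ((1 - α) - 1))
      (fun τ => (t - τ) ^ (-α) * deriv f τ) (uIoc 0 t) := fun τ hτ => by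
    rw [uIoc_of_le ht.le] at hτ
    simp only
    rw [(hd τ hτ.1).deriv, show 1 - α - 1 = -α by ring, mul_comm]
  refine ⟨fun τ hτ => ?_, fun τ hτ => (hd τ hτ.1).differentiableAt, hint.congr heq, ?_⟩
  · rcases hτ.1.eq_or_lt with rfl | h
    · exact hc.mono Icc_subset_Ici_self
    · exact (hd τ h).continuousAt.continuousWithinAt
  · rw [caputoDeriv, fractionalIntegral]
    congr 1
    refine (intervalIntegral.integral_congr_ae (Eventually.of_forall fun τ hτ => ?_)).symm
    exact heq hτ

theorem hasCaputoDeriv_rpow {α ν : ℝ} (hα : α < 1) (hν : 0 < ν) {t : ℝ} (ht : 0 < t) :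
    HasCaputoDeriv α (fun τ => τ ^ ν)
      (Real.Gamma (1 + ν) / Real.Gamma (1 + ν - α) * t ^ (ν - α)) t := by
  have hβ : 0 < 1 - α := by linarith
  have hI := fractionalIntegral_rpow hν hβ ht
  have hG1 := Real.Gamma_pos_of_pos hν
  have hG2 := Real.Gamma_pos_of_pos hβ
  have hG3 := Real.Gamma_pos_of_pos (add_pos hν hβ)
  have hint : IntervalIntegrable (fun τ => τ ^ (ν - 1) * (t - τ) ^ ((1 - α) - 1)) volume 0 t := by
    refine intervalIntegral.intervalIntegrable_of_integral_ne_zero ?_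
    rw [fractionalIntegral] at hI
    rw [hI]
    positivity
  have h := hasCaputoDeriv_of_hasDerivAt (α := α) (f := fun τ => τ ^ ν)
    (f' := fun τ => ν * τ ^ (ν - 1)) ht
    (Real.continuous_rpow_const hν.le).continuousWithinAt
    (fun τ hτ => Real.hasDerivAt_rpow_const (Or.inl hτ.ne'))
    (by simpa only [mul_assoc] using hint.const_mul ν)
  have hm : fractionalIntegral (1 - α) (fun τ => ν * τ ^ (ν - 1)) t =
      ν * fractionalIntegral (1 - α) (fun τ => τ ^ (ν - 1)) t := by
    simp only [fractionalIntegral, mul_assoc]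
    rw [intervalIntegral.integral_const_mul]
  rw [hm, hI] at h
  convert h using 1
  rw [add_comm 1 ν, Real.Gamma_add_one hν.ne', show ν + 1 - α = ν + (1 - α) by ring,
    show ν + (1 - α) - 1 = ν - α by ring]
  field_simp

/-! ### The self-similar profile -/

theorem wrightProfile_of_pos {α lam x t : ℝ} (ht : 0 < t) :
    wrightProfile α lam x t = wright (-(x / (lam * t ^ (α / 2)))) (-(α / 2)) 1 := if_pos ht

theorem wrightProfile_zero (α lam x : ℝ) : wrightProfile α lam x 0 = 0 := if_neg (lt_irrefl 0)

theorem div_mul_rpow_eq (α lam x : ℝ) {t : ℝ} (ht : 0 < t) :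
    x / (lam * t ^ (α / 2)) = x / lam * t ^ (-(α / 2)) := by
  rw [Real.rpow_neg ht.le]
  field_simp

section profile

variable {α lam : ℝ}

theorem wrightProfile_nonneg (hα₀ : 0 < α) (hα₁ : α < 1) (hlam : 0 < lam) {x t : ℝ}
    (hx : 0 ≤ x) : 0 ≤ wrightProfile α lam x t := by
  unfold wrightProfile
  split_ifs with h
  · exact wright_neg_nonneg (by linarith) (by linarith) (by positivity)
  · exact le_rfl

theorem wrightProfile_anti (hα₀ : 0 < α) (hα₁ : α < 1) (hlam : 0 < lam) {x y t : ℝ}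
    (hx : 0 ≤ x) (hxy : x ≤ y) : wrightProfile α lam y t ≤ wrightProfile α lam x t := by
  unfold wrightProfile
  split_ifs with h
  · refine antitoneOn_wright_neg (by linarith) (by linarith)
      (mem_Ici.mpr (by positivity)) (mem_Ici.mpr ?_) (by gcongr)
    have := hx.trans hxy
    positivity
  · exact le_rfl

theorem continuousWithinAt_wrightProfile_time (hα₀ : 0 < α) (hα₁ : α < 1) (hlam : 0 < lam) {x : ℝ}
    (hx : 0 < x) : ContinuousWithinAt (fun t => wrightProfile α lam x t) (Ici 0) 0 := by
  rw [← continuousWithinAt_Ioi_iff_Ici, ContinuousWithinAt, wrightProfile_zero]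
  refine (tendsto_wright_time_zero (ν := α / 2) (by linarith) (by linarith)
    (div_pos hx hlam)).congr' ?_
  filter_upwards [self_mem_nhdsWithin] with t ht
  rw [wrightProfile_of_pos ht, div_mul_rpow_eq α lam x ht]

theorem continuousAt_wrightProfile (hα₀ : 0 < α) (hα₁ : α < 1) (hlam : 0 < lam) {p : ℝ × ℝ}
    (hp : 0 < p.2) : ContinuousAt (fun q : ℝ × ℝ => wrightProfile α lam q.1 q.2) p := by
  have hc : ContinuousAt
      (fun q : ℝ × ℝ => wright (-(q.1 / (lam * q.2 ^ (α / 2)))) (-(α / 2)) 1) p := by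
    refine (continuous_wright (by linarith) (by linarith) le_rfl).continuousAt.comp
      (f := fun q : ℝ × ℝ => -(q.1 / (lam * q.2 ^ (α / 2)))) ?_
    refine (continuousAt_fst.div (continuousAt_const.mul
      (continuousAt_snd.rpow_const (Or.inl hp.ne'))) ?_).neg
    exact (mul_pos hlam (Real.rpow_pos_of_pos hp _)).ne'
  refine hc.congr ?_
  filter_upwards [continuousAt_snd.eventually (lt_mem_nhds hp)] with q hq
  rw [wrightProfile_of_pos hq]

/-- At `t = 0` the profile is squeezed between `0` and its values at the smaller abscissa
`x / 2`. -/
theorem continuousOn_wrightProfile (hα₀ : 0 < α) (hα₁ : α < 1) (hlam : 0 < lam) :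
    ContinuousOn (fun q : ℝ × ℝ => wrightProfile α lam q.1 q.2) {p | 0 ≤ p.2 ∧ 0 < p.1} := by
  rintro ⟨x, t⟩ ⟨ht, hx⟩
  simp only at ht hx
  rcases ht.eq_or_lt with rfl | ht
  · have h1 := continuousWithinAt_wrightProfile_time hα₀ hα₁ hlam (half_pos hx)
    rw [ContinuousWithinAt, wrightProfile_zero] at h1
    have h2 : Tendsto (fun q : ℝ × ℝ => q.2) (𝓝[{p | 0 ≤ p.2 ∧ 0 < p.1}] (x, 0)) (𝓝[Ici 0] 0) :=
      tendsto_nhdsWithin_iff.mpr ⟨(continuous_snd.tendsto (x, (0 : ℝ))).mono_left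
        nhdsWithin_le_nhds, by filter_upwards [self_mem_nhdsWithin] with q hq using hq.1⟩
    rw [ContinuousWithinAt]
    simp only [wrightProfile_zero]
    refine squeeze_zero' ?_ ?_ (h1.comp h2)
    · filter_upwards [self_mem_nhdsWithin] with q hq
      exact wrightProfile_nonneg hα₀ hα₁ hlam hq.2.le
    · have h3 : ∀ᶠ q : ℝ × ℝ in 𝓝 (x, (0 : ℝ)), x / 2 < q.1 :=
        continuous_fst.continuousAt.eventually (lt_mem_nhds (half_lt_self hx))
      filter_upwards [nhdsWithin_le_nhds h3] with q hq
      exact wrightProfile_anti hα₀ hα₁ hlam (half_pos hx).le hq.le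
  · exact (continuousAt_wrightProfile hα₀ hα₁ hlam (p := (x, t)) ht).continuousWithinAt

theorem hasCaputoDeriv_wrightProfile (hα₀ : 0 < α) (hα₁ : α < 1) (hlam : 0 < lam) {x t : ℝ}
    (hx : 0 < x) (ht : 0 < t) :
    HasCaputoDeriv α (fun τ => wrightProfile α lam x τ)
      (t ^ (-α) * wright (-(x / (lam * t ^ (α / 2)))) (-(α / 2)) (1 - α)) t := by
  have hν₀ : 0 < α / 2 := by linarith
  have hν : α / 2 < 1 / 2 := by linarith
  have hc := div_pos hx hlam
  have hβ : 0 < 1 - α := by linarith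
  obtain ⟨C, hC⟩ := exists_abs_wrightTime_le hν₀ hν hc one_pos
  have h := hasCaputoDeriv_of_hasDerivAt (α := α) (f := fun τ => wrightProfile α lam x τ)
    (f' := wrightTime (α / 2) 0 (x / lam)) ht
    (continuousWithinAt_wrightProfile_time hα₀ hα₁ hlam hx) ?_ ?_
  · rw [fractionalIntegral_wrightTime hν₀ hν hc hβ (by linarith) ht, wrightTime,
      ← div_mul_rpow_eq α lam x ht, show 1 - α - 1 = -α by ring, ← mul_assoc (1 / _),
      one_div_mul_cancel (Real.Gamma_pos_of_pos hβ).ne', one_mul] at h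
    exact h
  · intro τ hτ
    refine (hasDerivAt_wright_time hν₀ (by linarith) (x / lam) hτ).congr_of_eventuallyEq ?_
    filter_upwards [lt_mem_nhds hτ] with σ hσ
    rw [wrightProfile_of_pos hσ, div_mul_rpow_eq α lam x hσ]
  · have hmeas : AEStronglyMeasurable (wrightTime (α / 2) 0 (x / lam))
        (volume.restrict (Ioc 0 t)) :=
      ((continuousOn_wrightTime hν₀ (by linarith) zero_le_one _).mono
        Ioc_subset_Ioi_self).aestronglyMeasurable measurableSet_Ioc
    have hi := (intervalIntegrable_iff_integrableOn_Ioc_of_le ht.le).mp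
      (intervalIntegrable_sub_rpow hβ t)
    rw [intervalIntegrable_iff_integrableOn_Ioc_of_le ht.le]
    refine hi.bdd_mul hmeas (c := C) ?_
    exact (ae_restrict_mem measurableSet_Ioc).mono fun τ hτ => hC τ hτ.1

theorem hasDerivAt_wrightProfile (hα₀ : 0 < α) (hα₁ : α < 1) {t : ℝ} (ht : 0 < t) (x : ℝ) :
    HasDerivAt (fun y => wrightProfile α lam y t)
      (-mainardi (α / 2) (x / (lam * t ^ (α / 2))) / (lam * t ^ (α / 2))) x := by
  simp only [wrightProfile_of_pos ht]
  have h := HasDerivAt.comp x (hasDerivAt_wright_neg (ν := α / 2) (by linarith) (by linarith)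
    (x / (lam * t ^ (α / 2)))) ((hasDerivAt_id x).div_const (lam * t ^ (α / 2)))
  exact h.congr_deriv (by ring)

theorem contDiffAt_wrightProfile (hα₀ : 0 < α) (hα₁ : α < 1) {t : ℝ} (ht : 0 < t) (x : ℝ) :
    ContDiffAt ℝ 2 (fun y => wrightProfile α lam y t) x := by
  simp only [wrightProfile_of_pos ht]
  have h : ContDiffAt ℝ 2 (fun z => wright z (-(α / 2)) 1) (-(x / (lam * t ^ (α / 2)))) :=
    (analyticOnNhd_wright (by linarith) (by linarith) le_rfl _ (mem_univ _)).contDiffAt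
  exact h.comp x (f := fun y => -(y / (lam * t ^ (α / 2))))
    (contDiff_id.div_const _).neg.contDiffAt

/-- The self-similar profile satisfies the fractional diffusion equation; the solid and the liquid
temperature are affine functions of it. -/
theorem iteratedDeriv_two_const_add_mul_wrightProfile (hα₀ : 0 < α) (hα₁ : α < 1)
    (hlam : 0 < lam) {t : ℝ} (ht : 0 < t) (A B x : ℝ) :
    lam ^ 2 * iteratedDeriv 2 (fun y => A + B * wrightProfile α lam y t) x =
      B * (t ^ (-α) * wright (-(x / (lam * t ^ (α / 2)))) (-(α / 2)) (1 - α)) := by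
  have h1 : deriv (fun y => A + B * wrightProfile α lam y t) = fun y =>
      B * (-mainardi (α / 2) (y / (lam * t ^ (α / 2))) / (lam * t ^ (α / 2))) := by
    funext y
    exact (((hasDerivAt_wrightProfile hα₀ hα₁ ht y).const_mul B).const_add A).deriv
  have h2 := HasDerivAt.comp x (hasDerivAt_mainardi (ν := α / 2) (by linarith) (by linarith)
    (x / (lam * t ^ (α / 2)))) ((hasDerivAt_id x).div_const (lam * t ^ (α / 2)))
  have h3 := ((h2.neg.div_const (lam * t ^ (α / 2))).const_mul B).deriv
  have hsq : (t ^ (α / 2)) ^ 2 = t ^ α := by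
    rw [← Real.rpow_natCast, ← Real.rpow_mul ht.le]
    congr 1
    push_cast
    ring
  have hpos : 0 < t ^ (α / 2) := by positivity
  rw [iteratedDeriv_succ, iteratedDeriv_one, h1]
  refine (congrArg (lam ^ 2 * ·) h3).trans ?_
  rw [Real.rpow_neg ht.le, ← hsq, show 1 - 2 * (α / 2) = 1 - α by ring]
  field_simp

theorem tendsto_wrightProfile_atTop (hα₀ : 0 < α) (hα₁ : α < 1) (hlam : 0 < lam) {t : ℝ}
    (ht : 0 < t) : Tendsto (fun x => wrightProfile α lam x t) atTop (𝓝 0) := by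
  simp only [wrightProfile_of_pos ht]
  exact (tendsto_wright_neg_atTop (by linarith) (by linarith)).comp
    (tendsto_id.atTop_div_const (by positivity))

end profile

/-! ### The transcendental equation for the front -/

section equation

variable {α : ℝ}

theorem continuousOn_stefanF₁ (hα₀ : 0 < α) (hα₁ : α < 1) :
    ContinuousOn (stefanF₁ α) (Ioi 0) := by
  refine (continuous_mainardi (by linarith) (by linarith)).continuousOn.div
    (continuous_const.sub ((continuous_wright (by linarith) (by linarith) le_rfl).comp
      continuous_neg)).continuousOn fun x hx => ?_
  exact (sub_pos.mpr (wright_neg_lt_one (by linarith) (by linarith) hx)).ne'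

theorem continuousOn_stefanF₂ (hα₀ : 0 < α) (hα₁ : α < 1) :
    ContinuousOn (stefanF₂ α) (Ici 0) := by
  refine (continuous_mainardi (by linarith) (by linarith)).continuousOn.div
    ((continuous_wright (by linarith) (by linarith) le_rfl).comp
      continuous_neg).continuousOn fun x hx => ?_
  exact (wright_neg_pos (by linarith) (by linarith) hx).ne'

theorem stefanF₂_nonneg (hα₀ : 0 < α) (hα₁ : α < 1) {x : ℝ} (hx : 0 ≤ x) : 0 ≤ stefanF₂ α x :=
  div_nonneg (mainardi_nonneg (by linarith) (by linarith) hx)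
    (wright_neg_nonneg (by linarith) (by linarith) hx)

theorem tendsto_stefanF₁_zero (hα₀ : 0 < α) (hα₁ : α < 1) :
    Tendsto (stefanF₁ α) (𝓝[>] 0) atTop := by
  have hM : Tendsto (mainardi (α / 2)) (𝓝[>] 0) (𝓝 (mainardi (α / 2) 0)) :=
    ((continuous_mainardi (by linarith) (by linarith)).tendsto 0).mono_left nhdsWithin_le_nhds
  have hW : Tendsto (fun x => 1 - wright (-x) (-(α / 2)) 1) (𝓝[>] 0) (𝓝[>] 0) := by
    refine tendsto_nhdsWithin_iff.mpr ⟨?_, ?_⟩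
    · have h : Continuous fun x => 1 - wright (-x) (-(α / 2)) 1 :=
        continuous_const.sub ((continuous_wright (by linarith) (by linarith) le_rfl).comp
          continuous_neg)
      have h0 := h.tendsto 0
      rw [neg_zero, wright_zero_one, sub_self] at h0
      exact h0.mono_left nhdsWithin_le_nhds
    · filter_upwards [self_mem_nhdsWithin] with x hx
      exact sub_pos.mpr (wright_neg_lt_one (by linarith) (by linarith) hx)
  exact hM.pos_mul_atTop (mainardi_zero_pos (by linarith)) hW.inv_tendsto_nhdsGT_zero

theorem exists_stefanF₁_le (hα₀ : 0 < α) (hα₁ : α < 1) {x₀ : ℝ} (hx₀ : 0 < x₀) :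
    ∃ D, ∀ x, x₀ ≤ x → stefanF₁ α x ≤ D := by
  refine ⟨Real.pi⁻¹ * Real.Gamma (α / 2) / (1 - wright (-x₀) (-(α / 2)) 1), fun x hx => ?_⟩
  have hx' := hx₀.trans_le hx
  have hG := Real.Gamma_pos_of_pos (half_pos hα₀)
  have h1 := antitoneOn_wright_neg (ν := α / 2) (by linarith) (by linarith) hx₀.le hx'.le hx
  have h2 := sub_pos.mpr (wright_neg_lt_one (ν := α / 2) (by linarith) (by linarith) hx₀)
  have h3 := mainardi_le (ν := α / 2) (by linarith) (by linarith) hx'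
  simp only at h1
  unfold stefanF₁
  gcongr

/-- `F₁` blows up at `0` and is bounded at infinity, while `F₂ ≥ 0` is bounded at `0`. -/
theorem exists_stefanF_eq {k₁ k₂ ρ l lam₁ lam₂ u₀ um ui K : ℝ}
    (hα₀ : 0 < α) (hα₁ : α < 1) (hk₁ : 0 < k₁) (hk₂ : 0 < k₂) (hρ : 0 < ρ) (hl : 0 < l)
    (hlam₁ : 0 < lam₁) (hlam₂ : 0 < lam₂) (hui : ui < um) (hum : um < u₀) (hK : 0 < K) :
    ∃ ξ, 0 < ξ ∧ stefanF α k₁ k₂ ρ l lam₁ lam₂ u₀ um ui ξ = K * ξ := by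
  have hA : 0 < k₂ * (u₀ - um) / (ρ * l * lam₁ * lam₂) := by
    have := sub_pos.mpr hum
    positivity
  have hB : 0 < k₁ * (um - ui) / (ρ * l * lam₁ ^ 2) := by
    have := sub_pos.mpr hui
    positivity
  have hr : 0 < lam₁ / lam₂ := by positivity
  set A := k₂ * (u₀ - um) / (ρ * l * lam₁ * lam₂) with hAdef
  set B := k₁ * (um - ui) / (ρ * l * lam₁ ^ 2) with hBdef
  set r := lam₁ / lam₂ with hrdef
  have hF : ∀ x, stefanF α k₁ k₂ ρ l lam₁ lam₂ u₀ um ui x =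
      A * stefanF₁ α (r * x) - B * stefanF₂ α x := fun x => rfl
  have hcont : ContinuousOn (fun x => A * stefanF₁ α (r * x) - B * stefanF₂ α x) (Ioi 0) :=
    (continuousOn_const.mul ((continuousOn_stefanF₁ hα₀ hα₁).comp
      (Continuous.continuousOn (by fun_prop)) fun x hx => mul_pos hr hx)).sub
      (continuousOn_const.mul ((continuousOn_stefanF₂ hα₀ hα₁).mono Ioi_subset_Ici_self))
  have hscale : Tendsto (fun x => r * x) (𝓝[>] 0) (𝓝[>] 0) := by
    refine tendsto_nhdsWithin_iff.mpr ⟨?_, ?_⟩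
    · have h0 := (show Continuous fun x : ℝ => r * x by fun_prop).tendsto 0
      rw [mul_zero] at h0
      exact h0.mono_left nhdsWithin_le_nhds
    · filter_upwards [self_mem_nhdsWithin] with x hx using mul_pos hr hx
  have hzero : Tendsto (fun x => A * stefanF₁ α (r * x) + (-(B * stefanF₂ α x) - K * x))
      (𝓝[>] 0) atTop := by
    have h1 := ((tendsto_stefanF₁_zero hα₀ hα₁).comp hscale).const_mul_atTop hA
    have h2 : Tendsto (stefanF₂ α) (𝓝[>] 0) (𝓝 (stefanF₂ α 0)) :=
      (continuousOn_stefanF₂ hα₀ hα₁ 0 (mem_Ici.mpr le_rfl)).mono_left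
        (nhdsWithin_mono _ Ioi_subset_Ici_self)
    have h3 : Tendsto (fun x : ℝ => K * x) (𝓝[>] 0) (𝓝 (K * 0)) :=
      ((show Continuous fun x : ℝ => K * x by fun_prop).tendsto 0).mono_left nhdsWithin_le_nhds
    exact h1.atTop_add ((h2.const_mul B).neg.sub h3)
  obtain ⟨x₁, hx₁, hpos⟩ :=
    ((hzero.eventually_ge_atTop 0).and self_mem_nhdsWithin).exists
  obtain ⟨D, hD⟩ := exists_stefanF₁_le hα₀ hα₁ hr
  set x₂ := max 1 (A * D / K) with hx₂
  have hx₂1 : 1 ≤ x₂ := le_max_left _ _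
  have hneg : A * stefanF₁ α (r * x₂) - B * stefanF₂ α x₂ ≤ K * x₂ := by
    have h1 := hD (r * x₂) (le_mul_of_one_le_right hr.le hx₂1)
    have h2 := stefanF₂_nonneg hα₀ hα₁ (zero_le_one.trans hx₂1)
    have h3 : A * D ≤ K * x₂ := by
      rw [mul_comm K, ← div_le_iff₀ hK]
      exact le_max_right _ _
    have h4 := mul_le_mul_of_nonneg_left h1 hA.le
    have h5 := mul_nonneg hB.le h2
    linarith
  obtain ⟨ξ, hξ, h⟩ := isPreconnected_Ioi.intermediate_value₂ (a := x₂) (b := x₁)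
    (mem_Ioi.mpr (zero_lt_one.trans_le hx₂1)) hpos hcont
    (Continuous.continuousOn (f := fun x => K * x) (by fun_prop)) hneg (by linarith)
  exact ⟨ξ, hξ, (hF ξ).trans h⟩

end equation

/-! ### The generalized Neumann solution -/

theorem neumannSolid_eq (α lam₁ um ui ξ x t : ℝ) :
    neumannSolid α lam₁ um ui ξ x t =
      ui + (um - ui) / wright (-ξ) (-(α / 2)) 1 * wrightProfile α lam₁ x t := by
  rw [neumannSolid]
  ring

theorem neumannLiquid_eq (α lam₁ lam₂ u₀ um ξ x t : ℝ) :
    neumannLiquid α lam₁ lam₂ u₀ um ξ x t =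
      (u₀ - (u₀ - um) / (1 - wright (-(ξ * (lam₁ / lam₂))) (-(α / 2)) 1)) +
      (u₀ - um) / (1 - wright (-(ξ * (lam₁ / lam₂))) (-(α / 2)) 1) *
        wrightProfile α lam₂ x t := by
  rw [neumannLiquid]
  ring

theorem neumannFront_div {α lam₁ lam ξ t : ℝ} (ht : 0 < t) :
    neumannFront α lam₁ ξ t / (lam * t ^ (α / 2)) = ξ * (lam₁ / lam) := by
  have : t ^ (α / 2) ≠ 0 := (Real.rpow_pos_of_pos ht _).ne'
  rw [neumannFront, mul_div_mul_right _ _ this, mul_div_assoc]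

theorem isFractionalStefanSolution_neumann {α k₁ k₂ ρ l lam₁ lam₂ u₀ um ui ξ : ℝ}
    (hα₀ : 0 < α) (hα₁ : α < 1) (hρ : 0 < ρ) (hl : 0 < l)
    (hlam₁ : 0 < lam₁) (hlam₂ : 0 < lam₂) (hξ : 0 < ξ)
    (hF : stefanF α k₁ k₂ ρ l lam₁ lam₂ u₀ um ui ξ =
      Real.Gamma (1 + α / 2) / Real.Gamma (1 - α / 2) * ξ) :
    IsFractionalStefanSolution α k₁ k₂ ρ l lam₁ lam₂ u₀ um ui
      (neumannSolid α lam₁ um ui ξ) (neumannLiquid α lam₁ lam₂ u₀ um ξ)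
      (neumannFront α lam₁ ξ) := by
  have hν₀ : 0 < α / 2 := by linarith
  have hν : α / 2 < 1 / 2 := by linarith
  have hs : ∀ t, 0 < t → 0 < neumannFront α lam₁ ξ t := fun t ht => by
    unfold neumannFront
    positivity
  have hW₁ : wright (-ξ) (-(α / 2)) 1 ≠ 0 := (wright_neg_pos hν₀ hν hξ.le).ne'
  have hW₂ : 1 - wright (-(ξ * (lam₁ / lam₂))) (-(α / 2)) 1 ≠ 0 :=
    (sub_pos.mpr (wright_neg_lt_one hν₀ hν (by positivity))).ne'
  have hP₁ : ∀ t, 0 < t → wrightProfile α lam₁ (neumannFront α lam₁ ξ t) t =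
      wright (-ξ) (-(α / 2)) 1 := fun t ht => by
    rw [wrightProfile_of_pos ht, neumannFront_div ht, div_self hlam₁.ne', mul_one]
  have hP₂ : ∀ t, 0 < t → wrightProfile α lam₂ (neumannFront α lam₁ ξ t) t =
      wright (-(ξ * (lam₁ / lam₂))) (-(α / 2)) 1 := fun t ht => by
    rw [wrightProfile_of_pos ht, neumannFront_div ht]
  refine
    { s_pos := hs
      continuousOn_liquid := ?_
      continuousOn_solid := ?_
      smooth_liquid := ?_
      smooth_solid := ?_
      eq_liquid := ?_
      eq_solid := ?_
      stefan := ?_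
      interface_solid := ?_
      interface_liquid := ?_
      initial := ?_
      far_field := ?_
      boundary := ?_
      s_zero := ?_ }
  · simp only [neumannLiquid_eq]
    refine continuousOn_const.add (continuousOn_const.mul fun p hp => ?_)
    exact (continuousAt_wrightProfile hα₀ hα₁ hlam₂ hp.1).continuousWithinAt
  · simp only [neumannSolid_eq]
    exact continuousOn_const.add (continuousOn_const.mul
      ((continuousOn_wrightProfile hα₀ hα₁ hlam₁).mono fun p hp => ⟨hp.1, hp.2.1⟩))
  · intro x t ht _ _
    simp only [neumannLiquid_eq]
    exact contDiffAt_const.add (contDiffAt_const.mul (contDiffAt_wrightProfile hα₀ hα₁ ht x))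
  · intro x t ht _
    simp only [neumannSolid_eq]
    exact contDiffAt_const.add (contDiffAt_const.mul (contDiffAt_wrightProfile hα₀ hα₁ ht x))
  · intro x t ht hx _
    simp only [neumannLiquid_eq]
    rw [iteratedDeriv_two_const_add_mul_wrightProfile hα₀ hα₁ hlam₂ ht]
    exact (hasCaputoDeriv_wrightProfile hα₀ hα₁ hlam₂ hx ht).const_add_mul _ _
  · intro x t ht hx
    simp only [neumannSolid_eq]
    rw [iteratedDeriv_two_const_add_mul_wrightProfile hα₀ hα₁ hlam₁ ht]
    exact (hasCaputoDeriv_wrightProfile hα₀ hα₁ hlam₁ ((hs t ht).trans hx) ht).const_add_mul _ _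
  · intro t ht
    have hd₁ := (((hasDerivAt_wrightProfile (lam := lam₁) hα₀ hα₁ ht
      (neumannFront α lam₁ ξ t)).const_mul
        ((um - ui) / wright (-ξ) (-(α / 2)) 1)).const_add ui).hasDerivWithinAt
          (s := Ici (neumannFront α lam₁ ξ t))
    have hd₂ := (((hasDerivAt_wrightProfile (lam := lam₂) hα₀ hα₁ ht
      (neumannFront α lam₁ ξ t)).const_mul
        ((u₀ - um) / (1 - wright (-(ξ * (lam₁ / lam₂))) (-(α / 2)) 1))).const_add
          (u₀ - (u₀ - um) / (1 - wright (-(ξ * (lam₁ / lam₂))) (-(α / 2)) 1))).hasDerivWithinAt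
          (s := Iic (neumannFront α lam₁ ξ t))
    have hd := (hasCaputoDeriv_rpow hα₁ hν₀ ht).const_add_mul 0 (ξ * lam₁)
    simp only [neumannFront_div ht, div_self hlam₁.ne', mul_one] at hd₁ hd₂
    refine ⟨_, _, _, by simpa only [neumannSolid_eq] using hd₁,
      by simpa only [neumannLiquid_eq] using hd₂,
      by simp only [zero_add] at hd; exact hd, ?_⟩
    have hT : 0 < t ^ (α / 2) := by positivity
    rw [stefanF, stefanF₁, stefanF₂, mul_comm (lam₁ / lam₂) ξ] at hF
    rw [show 1 + α / 2 - α = 1 - α / 2 by ring, show α / 2 - α = -(α / 2) by ring,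
      Real.rpow_neg ht.le]
    have hgoal : ρ * l * (ξ * lam₁ * (Real.Gamma (1 + α / 2) / Real.Gamma (1 - α / 2) *
        (t ^ (α / 2))⁻¹)) = ρ * l * lam₁ * (t ^ (α / 2))⁻¹ *
        (Real.Gamma (1 + α / 2) / Real.Gamma (1 - α / 2) * ξ) := by ring
    rw [hgoal, ← hF]
    field_simp
    ring
  · intro t ht
    rw [neumannSolid_eq, hP₁ t ht, div_mul_cancel₀ _ hW₁]
    ring
  · intro t ht
    rw [neumannLiquid, hP₂ t ht, div_self hW₂]
    ring
  · intro x _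
    rw [neumannSolid_eq, wrightProfile_zero, mul_zero, add_zero]
  · intro t ht
    simp only [neumannSolid_eq]
    simpa using ((tendsto_wrightProfile_atTop hα₀ hα₁ hlam₁ ht).const_mul
      ((um - ui) / wright (-ξ) (-(α / 2)) 1)).const_add ui
  · intro t ht
    rw [neumannLiquid, wrightProfile_of_pos ht, zero_div, neg_zero, wright_zero_one, sub_self,
      zero_div, mul_zero, sub_zero]
  · rw [neumannFront, Real.zero_rpow hν₀.ne', mul_zero]

theorem theorem1 (α k₁ k₂ c₁ c₂ ρ l lam₁ lam₂ u₀ um ui : ℝ)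
    (hα₀ : 0 < α) (hα₁ : α < 1)
    (hk₁ : 0 < k₁) (hk₂ : 0 < k₂) (hc₁ : 0 < c₁) (hc₂ : 0 < c₂) (hρ : 0 < ρ) (hl : 0 < l)
    (hlam₁ : 0 < lam₁) (hlam₂ : 0 < lam₂)
    (hlam₁_sq : lam₁ ^ 2 = k₁ / (ρ * c₁)) (hlam₂_sq : lam₂ ^ 2 = k₂ / (ρ * c₂))
    (hui : ui < um) (hum : um < u₀) :
    (∃ ξ : ℝ, 0 < ξ ∧
      stefanF α k₁ k₂ ρ l lam₁ lam₂ u₀ um ui ξ =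
        Real.Gamma (1 + α / 2) / Real.Gamma (1 - α / 2) * ξ) ∧
    ∀ ξ : ℝ, 0 < ξ →
      stefanF α k₁ k₂ ρ l lam₁ lam₂ u₀ um ui ξ =
        Real.Gamma (1 + α / 2) / Real.Gamma (1 - α / 2) * ξ →
      IsFractionalStefanSolution α k₁ k₂ ρ l lam₁ lam₂ u₀ um ui
        (neumannSolid α lam₁ um ui ξ)
        (neumannLiquid α lam₁ lam₂ u₀ um ξ)
        (neumannFront α lam₁ ξ) := by

  have hG1 : 0 < Real.Gamma (1 + α / 2) := Real.Gamma_pos_of_pos (by linarith)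
  have hG2 : 0 < Real.Gamma (1 - α / 2) := Real.Gamma_pos_of_pos (by linarith)
  exact ⟨exists_stefanF_eq hα₀ hα₁ hk₁ hk₂ hρ hl hlam₁ hlam₂ hui hum (div_pos hG1 hG2),
    fun ξ hξ hF => isFractionalStefanSolution_neumann hα₀ hα₁ hρ hl hlam₁ hlam₂ hξ hF⟩
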